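/- **Conventions.** A semigroup $S$ with identity is *right LCM* if it is left cancellative and $pS\cap qS$ is, for all $p,q\in S$, empty or of the form $rS$. Let $A$ be a unital $C^*$-algebra. A *product system* of right-Hilbert $A$-bimodules over $S$ is a semigroup $M=\bigsqcup_{p\in S}M_p$ in which each $M_p$ is a right-Hilbert $A$-bimodule (a right Hilbert $A$-module with a left action $\varphi_p$ of $A$ by adjointable operators), $x\otimes y\mapsto xy$ induces an isomorphism $M_p\otimes_A M_q\cong M_{pq}$ for all $p,q\in S$ with $p\neq 1$, $M_1={}_AA_A$, and the products $M_1\times M_p\to M_p$ and $M_p\times M_1\to M_p$ are the module actions. Let $\Theta_{\xi,\eta}(\mu)=\xi\cdot\langle\eta,\mu\rangle$, let $\mathcal K(M_p)=\overline{\operatorname{span}}\{\Theta_{\xi,\eta}\mid \xi,\eta\in M_p\}$, and let $\iota_p^{pq}:\mathcal L(M_p)\to\mathcal L(M_{pq})$ be the homomorphism $T\mapsto T\otimes\mathrm{id}_{M_q}$, i.e. $\iota_p^{pq}(T)(\xi\eta)=(T\xi)\eta$ (and $\iota_p^{pq}(T)=0$ on the orthogonal complement of $M_pM_q$, which is $0$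 unless $p=1$). $M$ is *compactly aligned* if $\iota_p^r(T)\,\iota_q^r(T')\in\mathcal K(M_r)$ whenever $pS\cap qS=rS$, $T\in\mathcal K(M_p)$ and $T'\in\mathcal K(M_q)$. A *Parseval frame* for a right Hilbert $A$-module $Y$ is a countable family $(\xi_i)_{i\in I}$ in $Y$ with $\eta=\sum_{i\in I}\xi_i\cdot\langle\xi_i,\eta\rangle$ (unconditional norm convergence) for all $\eta\in Y$. An *algebraic dynamical system* $(G,P,\theta)$ consists of a countable discrete group $G$, a countable right LCM semigroup $P$ with identity, and an action $\theta$ of $P$ by injective endomorphisms of $G$ such that $\theta_p(G)\cap\theta_q(G)=\theta_r(G)$ whenever $pP\cap qP=rP$. Let $\delta_g$ ($g\in G$) be the canonical unitaries of the full group $C^*$-algebra $C^*(G)$, let $\alpha_p$ be the endomorphism of $C^*(G)$ with $\alpha_p(\delta_g)=\delta_{\theta_p(g)}$, and let $L_p:C^*(G)\to C^*(G)$ be the bounded linear map with $L_p(\delta_g)=\delta_{\theta_p^{-1}(g)}$ if $g\in\theta_p(G)$ and $L_p(\delta_g)=0$ otherwise. Let $M_p$ be the Hausdorff completion of $C^*(G)$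 for the pre-inner product $\langle a,b\rangle_p=L_p(a^*b)$, with right action $a\cdot b=a\alpha_p(b)$ and with left action by left multiplication, and let $\pi_p:C^*(G)\to M_p$ be the canonical map. The *product system of* $(G,P,\theta)$ is $M=\bigsqcup_{p\in P}M_p$ with the product determined by $\pi_p(\delta_g)\pi_q(\delta_h)=\pi_{pq}(\delta_{g\theta_p(h)})$. **Statement.** 1. Let $A$ be a unital $C^*$-algebra, $S$ a right LCM semigroup with identity, and $M$ a product system of right-Hilbert $A$-bimodules over $S$ such that the following condition holds. (CA) Whenever $p,q,r\in S$ satisfy $pS\cap qS=rS$, there are Parseval frames $(\xi_i)_{i\in I}$ for $M_p$ and $(\eta_j)_{j\in J}$ for $M_q$ such that $\iota_p^r(\Theta_{\xi_i,\xi_i})\,\iota_q^r(\Theta_{\eta_j,\eta_j})\in\mathcal K(M_r)$ for all $i\in I$, $j\in J$. Then $M$ is compactly aligned. 2. For every algebraic dynamical system $(G,P,\theta)$ the product system $M$ of $(G,P,\theta)$ is compactly aligned. No assumption is made on the left actions: for $p\in P$ one has $\varphi_p(C^*(G))\subset\mathcal K(M_p)$ if and only if $G/\theta_p(G)$ is finite.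 3. There is an algebraic dynamical system $(G,P,\theta)$ with $P\neq\{1\}$ whose (compactly aligned) product system satisfies $\varphi_p(C^*(G))\not\subset\mathcal K(M_p)$ for all $p\in P\setminus\{1\}$. -/

import Mathlib

namespace CStarProductSystem

universe u v w

open scoped ComplexConjugate

section SemiInner

/-- A semi-inner product on a complex vector space `V` with values in a C⋆-algebra `A`, linear in
the second variable. The last field says that `x · ⟨x, y⟩` makes sense in `V`. -/
structure SemiInner (A : Type u) (V : Type v) [CStarAlgebra A] [AddCommGroup V] [Module ℂ V] where
  ip : V → V → A
  add_right : ∀ x y z, ip x (y + z) = ip x y + ip x z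
  smul_right : ∀ (c : ℂ) x y, ip x (c • y) = c • ip x y
  star_ip : ∀ x y, star (ip x y) = ip y x
  pos : ∀ x, ∃ b : A, ip x x = star b * b
  act : ∀ x y, ∃ z, ∀ w, ip w z = ip w x * ip x y

namespace SemiInner

variable {A : Type u} {V : Type v} [CStarAlgebra A] [AddCommGroup V] [Module ℂ V]
  (h : SemiInner A V)

theorem add_left (x y z : V) : h.ip (x + y) z = h.ip x z + h.ip y z := by
  rw [← h.star_ip, h.add_right, star_add, h.star_ip, h.star_ip]

theorem smul_left (c : ℂ) (x y : V) : h.ip (c • x) y = conj c • h.ip x y := by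
  rw [← h.star_ip, h.smul_right, star_smul, h.star_ip]; rfl

theorem cauchy_schwarz (x y : V) : ‖h.ip x y‖ ^ 2 ≤ ‖h.ip x x‖ * ‖h.ip y y‖ := by
  let _ := CStarAlgebra.spectralOrder A
  let _ := CStarAlgebra.spectralOrderedRing A
  obtain ⟨z, hz⟩ := h.act x y
  set c := h.ip x y with hc
  set N := ‖h.ip x x‖ with hN
  have hyx : h.ip y x = star c := (h.star_ip x y).symm
  have hyz : h.ip y z = star c * c := by rw [hz, hyx]
  have hzy : h.ip z y = star c * c := by rw [← h.star_ip, hyz]; simp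
  have hzx : h.ip z x = star c * h.ip x x := by
    rw [← h.star_ip, hz, star_mul, h.star_ip x x]
  have hzz : h.ip z z = star c * h.ip x x * c := by rw [hz, hzx]
  have hpos : 0 ≤ h.ip x x := by
    obtain ⟨b, hb⟩ := h.pos x
    rw [hb]; exact star_mul_self_nonneg b
  have key : ∀ t : ℝ, (2 * t - t ^ 2 * N) • (star c * c) ≤ h.ip y y := by
    intro t
    have h0 : 0 ≤ h.ip (y + (-(t : ℂ)) • z) (y + (-(t : ℂ)) • z) := by
      obtain ⟨b, hb⟩ := h.pos (y + (-(t : ℂ)) • z)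
      rw [hb]; exact star_mul_self_nonneg b
    have h1 : h.ip (y + (-(t : ℂ)) • z) (y + (-(t : ℂ)) • z)
        = h.ip y y - (2 * t) • (star c * c) + (t ^ 2) • (star c * h.ip x x * c) := by
      rw [h.add_right, h.add_left, h.add_left, h.smul_right, h.smul_right, h.smul_left,
        h.smul_left, hyz, hzy, hzz]
      have e : ∀ (s : ℝ) (a : A), s • a = (s : ℂ) • a := fun s a => (RCLike.real_smul_eq_coe_smul (K := ℂ) s a)
      rw [e, e]
      simp only [map_neg, Complex.conj_ofReal]
      push_cast
      module
    have h2 : star c * h.ip x x * c ≤ N • (star c * c) :=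
      CStarAlgebra.star_left_conjugate_le_norm_smul
    have h3 : (t ^ 2) • (star c * h.ip x x * c) ≤ (t ^ 2) • (N • (star c * c)) :=
      smul_le_smul_of_nonneg_left h2 (sq_nonneg t)
    rw [h1] at h0
    have h4 := h0.trans (add_le_add_right h3 _)
    rw [← sub_nonneg]
    convert h4 using 1
    module
  have key2 : ∀ t : ℝ, 0 ≤ 2 * t - t ^ 2 * N →
      (2 * t - t ^ 2 * N) * ‖c‖ ^ 2 ≤ ‖h.ip y y‖ := by
    intro t ht
    have := CStarAlgebra.norm_le_norm_of_nonneg_of_le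
      (smul_nonneg ht (star_mul_self_nonneg c)) (key t)
    rwa [norm_smul, Real.norm_of_nonneg ht, CStarRing.norm_star_mul_self, ← sq] at this
  have hN0 : 0 ≤ N := norm_nonneg _
  rcases hN0.eq_or_lt with h0 | h0
  · have hy0 : 0 ≤ ‖h.ip y y‖ := norm_nonneg _
    have := key2 (‖h.ip y y‖ / ‖c‖ ^ 2) (by rw [← h0, mul_zero, sub_zero]; positivity)
    rw [← h0] at this ⊢
    by_cases hc0 : ‖c‖ = 0
    · simp [hc0]
    · have hk := key2 ((‖h.ip y y‖ + 1) / ‖c‖ ^ 2) (by rw [← h0, mul_zero, sub_zero]; positivity)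
      rw [← h0] at hk
      field_simp at hk
      nlinarith
  · have := key2 (1 / N) (by field_simp; norm_num)
    field_simp at this
    nlinarith

/-- The seminorm `‖x‖ = ‖⟨x, x⟩‖ ^ (1/2)`. -/
noncomputable def seminorm : Seminorm ℂ V :=
  Seminorm.of (fun x => √‖h.ip x x‖)
    (by
      intro x y
      have c1 := h.cauchy_schwarz x y
      have hx : √‖h.ip x x‖ ^ 2 = ‖h.ip x x‖ := Real.sq_sqrt (norm_nonneg _)
      have hy : √‖h.ip y y‖ ^ 2 = ‖h.ip y y‖ := Real.sq_sqrt (norm_nonneg _)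
      have c2 : ‖h.ip x y‖ ≤ √‖h.ip x x‖ * √‖h.ip y y‖ := by
        apply abs_le_of_sq_le_sq' _ (by positivity) |>.2
        rw [mul_pow, hx, hy]; exact c1
      have c3 : ‖h.ip y x‖ = ‖h.ip x y‖ := by rw [← h.star_ip, norm_star]
      apply Real.sqrt_le_iff.2 ⟨by positivity, _⟩
      rw [h.add_right, h.add_left, h.add_left]
      calc _ ≤ ‖h.ip x x‖ + ‖h.ip y x‖ + (‖h.ip x y‖ + ‖h.ip y y‖) :=
            (norm_add_le _ _).trans (add_le_add (norm_add_le _ _) (norm_add_le _ _))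
        _ ≤ _ := by rw [c3]; nlinarith)
    (by
      intro c x
      show √‖h.ip (c • x) (c • x)‖ = ‖c‖ * √‖h.ip x x‖
      rw [h.smul_right, h.smul_left, norm_smul, norm_smul, RCLike.norm_conj, ← mul_assoc,
        Real.sqrt_mul (by positivity), ← sq, Real.sqrt_sq (norm_nonneg _)])

theorem seminorm_apply (x : V) : h.seminorm x = √‖h.ip x x‖ := rfl

theorem seminorm_sq (x : V) : h.seminorm x ^ 2 = ‖h.ip x x‖ := by
  rw [seminorm_apply, Real.sq_sqrt (norm_nonneg _)]

theorem norm_ip_le (x y : V) : ‖h.ip x y‖ ≤ h.seminorm x * h.seminorm y := by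
  apply abs_le_of_sq_le_sq' _ (by positivity) |>.2
  rw [mul_pow, seminorm_sq, seminorm_sq]; exact h.cauchy_schwarz x y

end SemiInner

end SemiInner

end CStarProductSystem

namespace CStarProductSystem

universe u v w

/-! ### Right-Hilbert bimodules -/

/-- A right-Hilbert `A`-bimodule structure on a complex Banach space `E`: a right `A`-module with
an `A`-valued inner product that is linear in the second variable and induces the norm, together
with a left action of `A` by adjointable operators. (Boundedness of the two actions, which is part
of their types, is automatic. The left action of `1` need not be the identity.) -/
class RightHilbertBimodule (A : Type u) (E : Type v) [CStarAlgebra A] [NormedAddCommGroup E]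
    [NormedSpace ℂ E] where
  complete : CompleteSpace E
  /-- the inner product `⟨x, y⟩` -/
  ip : E → E → A
  /-- the right action `x · a` -/
  ract : E →L[ℂ] A →L[ℂ] E
  /-- the left action `φ(a) x` -/
  lact : A →L[ℂ] E →L[ℂ] E
  ract_one : ∀ x, ract x 1 = x
  ract_mul : ∀ x a b, ract x (a * b) = ract (ract x a) b
  ip_add_right : ∀ x y z, ip x (y + z) = ip x y + ip x z
  ip_smul_right : ∀ (c : ℂ) x y, ip x (c • y) = c • ip x y
  ip_ract_right : ∀ x y a, ip x (ract y a) = ip x y * a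
  star_ip : ∀ x y, star (ip x y) = ip y x
  ip_self_pos : ∀ x, ∃ b : A, ip x x = star b * b
  norm_sq : ∀ x, ‖x‖ ^ 2 = ‖ip x x‖
  lact_mul : ∀ a b x, lact (a * b) x = lact a (lact b x)
  ip_lact_left : ∀ a x y, ip (lact a x) y = ip x (lact (star a) y)

section Bimodule

open RightHilbertBimodule

variable (A : Type u) {E : Type v} [CStarAlgebra A] [NormedAddCommGroup E]
    [NormedSpace ℂ E] [RightHilbertBimodule A E]

/-- The inner product of a right-Hilbert bimodule as a semi-inner product. -/
def bimoduleSemiInner (E : Type v) [NormedAddCommGroup E]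
    [NormedSpace ℂ E] [RightHilbertBimodule A E] : SemiInner A E where
  ip := ip
  add_right := ip_add_right
  smul_right := ip_smul_right
  star_ip := star_ip
  pos := ip_self_pos
  act x y := ⟨ract x (ip x y), fun w => ip_ract_right w x _⟩

theorem norm_ip_le (x y : E) : ‖(ip x y : A)‖ ≤ ‖x‖ * ‖y‖ := by
  have h : ∀ x : E, (bimoduleSemiInner A E).seminorm x = ‖x‖ := fun x => by
    rw [← sq_eq_sq₀ (apply_nonneg _ _) (norm_nonneg _), SemiInner.seminorm_sq, norm_sq (A := A)]
    rfl
  have := (bimoduleSemiInner A E).norm_ip_le x y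
  rwa [h, h] at this

/-- The bounded linear map `y ↦ ⟨x, y⟩`. -/
noncomputable def ipRight (x : E) : E →L[ℂ] A :=
  LinearMap.mkContinuous
    { toFun := fun y => ip x y
      map_add' := ip_add_right x
      map_smul' := fun c y => ip_smul_right c x y } ‖x‖ (norm_ip_le A x)

/-- The rank-one operator `Θ_{ξ,η} : μ ↦ ξ · ⟨η, μ⟩`. -/
noncomputable def rankOne (ξ η : E) : E →L[ℂ] E := (ract ξ).comp (ipRight A η)

/-- The generalised compact operators: the closed linear span of the rank-one operators. -/
noncomputable def compacts (E : Type v) [NormedAddCommGroup E]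
    [NormedSpace ℂ E] [RightHilbertBimodule A E] : Submodule ℂ (E →L[ℂ] E) :=
  (Submodule.span ℂ {T | ∃ ξ η : E, T = rankOne A ξ η}).topologicalClosure

/-- `T` has an adjoint with respect to the `A`-valued inner product. -/
def IsAdjointable (T : E →L[ℂ] E) : Prop :=
  ∃ T' : E →L[ℂ] E, ∀ x y : E, (ip (T x) y : A) = ip x (T' y)

/-- `A` acts from the left by generalised compact operators. -/
def LeftActsByCompacts (E : Type v) [NormedAddCommGroup E]
    [NormedSpace ℂ E] [RightHilbertBimodule A E] : Prop :=
  ∀ a : A, (lact a : E →L[ℂ] E) ∈ compacts A E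

/-- A Parseval frame: a countable family `ξ` with the reconstruction formula
`η = ∑ i, ξ i · ⟨ξ i, η⟩` (unconditional convergence in norm) for every `η`. -/
def IsParsevalFrame {I : Type w} (ξ : I → E) : Prop :=
  Countable I ∧ ∀ η : E, HasSum (fun i => ract (ξ i) (ip (ξ i) η : A)) η

end Bimodule

/-! ### Right LCM semigroups and product systems -/

/-- The principal right ideal `pS`. -/
def rightIdeal {S : Type v} [Monoid S] (p : S) : Set S := {x | ∃ y, x = p * y}

/-- A semigroup with identity is right LCM if it is left cancellative and the intersection of two
principal right ideals is empty or a principal right ideal. -/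
structure IsRightLCM (S : Type v) [Monoid S] : Prop where
  left_cancel : ∀ p x y : S, p * x = p * y → x = y
  lcm : ∀ p q : S, rightIdeal p ∩ rightIdeal q = ∅ ∨
    ∃ r : S, rightIdeal p ∩ rightIdeal q = rightIdeal r

open RightHilbertBimodule in
/-- A product system of right-Hilbert `A`-bimodules over `S`. The product of `x ∈ M_p` and
`y ∈ M_q` lies in `M_r` for `r = p * q`; to avoid transports along equalities in `S` it is indexed
by a proof of `p * q = r`. The fields `ip_mul` and `dense_mul` say that `x ⊗ y ↦ x y` is a
well-defined isometry of the (completed, balanced) tensor product `M_p ⊗_A M_q` into `M_r` and is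
onto if `p ≠ 1`; it is balanced and a bimodule map by `assoc`, `unit_mul` and `mul_unit`. -/
structure ProductSystem (A : Type u) (S : Type v) [CStarAlgebra A] [Monoid S] where
  Fibre : S → Type w
  [normed : ∀ p, NormedAddCommGroup (Fibre p)]
  [space : ∀ p, NormedSpace ℂ (Fibre p)]
  [bimodule : ∀ p, RightHilbertBimodule A (Fibre p)]
  /-- the product `M_p × M_q → M_r`, `r = p * q` -/
  mul : ∀ {p q r : S}, p * q = r → (Fibre p →L[ℂ] Fibre q →L[ℂ] Fibre r)
  assoc : ∀ {p q r a b s : S} (h₁ : p * q = a) (h₂ : a * r = s) (h₃ : q * r = b)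
    (h₄ : p * b = s) (x : Fibre p) (y : Fibre q) (z : Fibre r),
    mul h₂ (mul h₁ x y) z = mul h₄ x (mul h₃ y z)
  ip_mul : ∀ {p q r : S} (h : p * q = r) (x x' : Fibre p) (y y' : Fibre q),
    (ip (mul h x y) (mul h x' y') : A) = ip y (lact (ip x x' : A) y')
  dense_mul : ∀ {p q r : S} (h : p * q = r), p ≠ 1 →
    (Submodule.span ℂ {z | ∃ x y, z = mul h x y}).topologicalClosure = ⊤
  /-- the identification of the bimodule `M_1` with `A` -/
  unit : A ≃L[ℂ] Fibre 1
  ip_unit : ∀ a b, (ip (unit a) (unit b) : A) = star a * b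
  ract_unit : ∀ a b, ract (unit a) b = unit (a * b)
  lact_unit : ∀ a b, lact b (unit a) = unit (b * a)
  unit_mul : ∀ (p : S) (a : A) (x : Fibre p), mul (one_mul p) (unit a) x = lact a x
  mul_unit : ∀ (p : S) (x : Fibre p) (a : A), mul (mul_one p) x (unit a) = ract x a

attribute [instance] ProductSystem.normed ProductSystem.space ProductSystem.bimodule

namespace ProductSystem

open RightHilbertBimodule

variable {A : Type u} {S : Type v} [CStarAlgebra A] [Monoid S]

/-- `R = ι_p^r(T) = T ⊗ id`: here `r = p * q` for some `q`, `R (x y) = (T x) y`, and `R` vanishes on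
the orthogonal complement of the products. (That complement is zero unless `p = 1` and the left
action on `M_r` is degenerate.) -/
def IsAmplification (M : ProductSystem.{u, v, w} A S) {p r : S} (T : M.Fibre p →L[ℂ] M.Fibre p)
    (R : M.Fibre r →L[ℂ] M.Fibre r) : Prop :=
  (∃ q, p * q = r) ∧ ∀ (q : S) (h : p * q = r),
    (∀ x y, R (M.mul h x y) = M.mul h (T x) y) ∧
    ∀ z, (∀ x y, (ip (M.mul h x y) z : A) = 0) → R z = 0

open Classical in
/-- The homomorphism `ι_p^r`, with `ι_p^r = 0` if `r ∉ pS`. -/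
noncomputable def iota (M : ProductSystem.{u, v, w} A S) (p r : S)
    (T : M.Fibre p →L[ℂ] M.Fibre p) : M.Fibre r →L[ℂ] M.Fibre r :=
  if h : ∃ R, M.IsAmplification T R then h.choose else 0

/-- Compactly aligned product systems. -/
def IsCompactlyAligned (M : ProductSystem.{u, v, w} A S) : Prop :=
  ∀ p q r : S, rightIdeal p ∩ rightIdeal q = rightIdeal r →
    ∀ T ∈ compacts A (M.Fibre p), ∀ T' ∈ compacts A (M.Fibre q),
      (M.iota p r T).comp (M.iota q r T') ∈ compacts A (M.Fibre r)

/-- Condition (CA). -/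
def ConditionCA (M : ProductSystem.{u, v, w} A S) : Prop :=
  ∀ p q r : S, rightIdeal p ∩ rightIdeal q = rightIdeal r →
    ∃ (I J : Type) (ξ : I → M.Fibre p) (η : J → M.Fibre q),
      IsParsevalFrame A ξ ∧ IsParsevalFrame A η ∧
      ∀ i j, (M.iota p r (rankOne A (ξ i) (ξ i))).comp (M.iota q r (rankOne A (η j) (η j)))
        ∈ compacts A (M.Fibre r)

end ProductSystem

end CStarProductSystem

namespace CStarProductSystem.ProductSystem

universe u v w

open RightHilbertBimodule

variable {A : Type u} {S : Type v} [CStarAlgebra A] [Monoid S]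

section Amplification

open TensorProduct

variable (M : ProductSystem.{u, v, w} A S) {p q r : S} (h : p * q = r)

/-- The map `x ⊗ y ↦ (T x) y` on the algebraic tensor product. -/
noncomputable def preAmp (T : M.Fibre p →L[ℂ] M.Fibre p) :
    M.Fibre p ⊗[ℂ] M.Fibre q →ₗ[ℂ] M.Fibre r :=
  TensorProduct.lift (ContinuousLinearMap.toLinearMap₁₂ ((M.mul h).comp T))

theorem preAmp_tmul (T : M.Fibre p →L[ℂ] M.Fibre p) (x : M.Fibre p) (y : M.Fibre q) :
    M.preAmp h T (x ⊗ₜ y) = M.mul h (T x) y := by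
  simp [preAmp]

theorem ip_zero_left {E : Type w} [NormedAddCommGroup E] [NormedSpace ℂ E]
    [RightHilbertBimodule A E] (x : E) : (ip 0 x : A) = 0 := by
  rw [← star_ip]
  exact (congrArg star (ipRight A x).map_zero).trans (star_zero A)

theorem ip_zero_right {E : Type w} [NormedAddCommGroup E] [NormedSpace ℂ E]
    [RightHilbertBimodule A E] (x : E) : (ip x 0 : A) = 0 := (ipRight A x).map_zero

theorem ip_preAmp (T T' R R' : M.Fibre p →L[ℂ] M.Fibre p)
    (hT : ∀ x y, (ip (T x) (R y) : A) = ip (T' x) (R' y))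
    (z w : M.Fibre p ⊗[ℂ] M.Fibre q) :
    (ip (M.preAmp h T z) (M.preAmp h R w) : A) = ip (M.preAmp h T' z) (M.preAmp h R' w) := by
  induction z with
  | zero => simp only [map_zero, ip_zero_left]
  | add z₁ z₂ h₁ h₂ =>
    rw [map_add, map_add]
    refine ((bimoduleSemiInner A _).add_left _ _ _).trans
      (Eq.trans ?_ ((bimoduleSemiInner A _).add_left _ _ _).symm)
    exact congrArg₂ _ h₁ h₂
  | tmul x y =>
    induction w with
    | zero => simp only [map_zero, ip_zero_right]
    | add z₁ z₂ h₁ h₂ => rw [map_add, map_add, ip_add_right, ip_add_right, h₁, h₂]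
    | tmul x' y' => simp only [preAmp_tmul, M.ip_mul, hT]

theorem preAmp_le_pow (T : M.Fibre p →L[ℂ] M.Fibre p) (z : M.Fibre p ⊗[ℂ] M.Fibre q) :
    ∃ K : ℝ, 0 ≤ K ∧ ∀ n : ℕ, ‖M.preAmp h (T ^ n) z‖ ≤ ‖T‖ ^ n * K := by
  induction z with
  | zero => exact ⟨0, le_rfl, fun n => by simp⟩
  | add z₁ z₂ h₁ h₂ =>
    obtain ⟨K₁, h₁, k₁⟩ := h₁
    obtain ⟨K₂, h₂, k₂⟩ := h₂
    refine ⟨K₁ + K₂, by positivity, fun n => ?_⟩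
    rw [map_add, mul_add]
    exact (norm_add_le _ _).trans (add_le_add (k₁ n) (k₂ n))
  | tmul x y =>
    refine ⟨‖M.mul h‖ * ‖x‖ * ‖y‖, by positivity, fun n => ?_⟩
    rw [preAmp_tmul]
    have h2 : ‖(T ^ n) x‖ ≤ ‖T‖ ^ n * ‖x‖ := by
      induction n with
      | zero => simp
      | succ n ih =>
        rw [pow_succ', mul_apply_eq_comp]
        calc _ ≤ ‖T‖ * (‖T‖ ^ n * ‖x‖) := (T.le_opNorm _).trans (by gcongr)
          _ = _ := by ring
    calc _ ≤ ‖M.mul h‖ * ‖(T ^ n) x‖ * ‖y‖ := (M.mul h).le_opNorm₂ _ _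
      _ ≤ ‖M.mul h‖ * (‖T‖ ^ n * ‖x‖) * ‖y‖ := by gcongr
      _ = _ := by ring

theorem norm_preAmp_selfAdjoint (T : M.Fibre p →L[ℂ] M.Fibre p)
    (hT : ∀ x y, (ip (T x) y : A) = ip x (T y)) (z : M.Fibre p ⊗[ℂ] M.Fibre q) :
    ‖M.preAmp h T z‖ ≤ ‖T‖ * ‖M.preAmp h 1 z‖ := by
  have hpow : ∀ n : ℕ, ∀ x y, (ip ((T ^ n) x) y : A) = ip x ((T ^ n) y) := by
    intro n
    induction n with
    | zero => intro x y; rfl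
    | succ n ih =>
      intro x y
      calc (ip ((T ^ (n + 1)) x) y : A) = ip ((T ^ n) (T x)) y := by rw [pow_succ]; rfl
        _ = ip x (T ((T ^ n) y)) := by rw [ih, hT]
        _ = ip x ((T ^ (n + 1)) y) := by rw [pow_succ']; rfl
  have hsq : ∀ n : ℕ, ‖M.preAmp h (T ^ n) z‖ ^ 2 ≤
      ‖M.preAmp h 1 z‖ * ‖M.preAmp h (T ^ (n * 2)) z‖ := by
    intro n
    rw [norm_sq (A := A), M.ip_preAmp h (T ^ n) 1 (T ^ n) (T ^ (n * 2))]
    · exact norm_ip_le A _ _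
    · intro x y
      rw [hpow, pow_mul, sq]; rfl
  obtain ⟨K, hK, hb⟩ := M.preAmp_le_pow h T z
  set c := ‖M.preAmp h 1 z‖
  have hc : 0 ≤ c := norm_nonneg _
  have hiter : ∀ n : ℕ, ‖M.preAmp h T z‖ ^ (2 ^ n) * c ≤
      c ^ (2 ^ n) * ‖M.preAmp h (T ^ (2 ^ n)) z‖ := by
    intro n
    induction n with
    | zero => simp [mul_comm]
    | succ n ih =>
      have h1 := hsq (2 ^ n)
      rw [← pow_succ] at h1
      rcases hc.eq_or_lt with h0 | h0
      · rw [← h0]; simp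
      · have h2 := pow_le_pow_left₀ (by positivity) ih 2
        rw [mul_pow, mul_pow, ← pow_mul, ← pow_mul, ← pow_succ] at h2
        have h3 := h2.trans (mul_le_mul_of_nonneg_left h1 (by positivity))
        apply le_of_mul_le_mul_right _ h0
        calc _ = ‖M.preAmp h T z‖ ^ 2 ^ (n + 1) * c ^ 2 := by ring
          _ ≤ _ := h3
          _ = _ := by ring
  rcases hc.eq_or_lt with h0 | h0
  · have := hsq 1
    rw [pow_one, ← h0, zero_mul] at this
    rw [← h0, mul_zero]
    nlinarith [norm_nonneg (M.preAmp h T z)]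
  · by_contra hlt
    push Not at hlt
    have hu : ∀ n : ℕ, ‖M.preAmp h T z‖ ^ (2 ^ n) * c ≤ (‖T‖ * c) ^ (2 ^ n) * K := fun n =>
      (hiter n).trans (by
        rw [mul_pow, mul_comm (‖T‖ ^ _), mul_assoc]
        exact mul_le_mul_of_nonneg_left (hb _) (by positivity))
    have hT0 : 0 ≤ ‖T‖ * c := by positivity
    rcases hT0.eq_or_lt with hT1 | hT1
    · have := hu 0
      rw [← hT1] at this hlt
      simp only [pow_zero, pow_one, zero_mul] at this
      have : 0 < ‖M.preAmp h T z‖ * c := by positivity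
      linarith
    · have hone : 1 < ‖M.preAmp h T z‖ / (‖T‖ * c) := by rwa [one_lt_div hT1]
      obtain ⟨n, hn⟩ := pow_unbounded_of_one_lt (K / c) hone
      have hn2 : K / c < (‖M.preAmp h T z‖ / (‖T‖ * c)) ^ 2 ^ n :=
        hn.trans_le (pow_le_pow_right₀ hone.le (Nat.lt_two_pow_self).le)
      rw [div_pow, div_lt_div_iff₀ h0 (by positivity)] at hn2
      have := hu n
      linarith [mul_comm K ((‖T‖ * c) ^ 2 ^ n)]

theorem norm_preAmp_le (T : M.Fibre p →L[ℂ] M.Fibre p) (hT : IsAdjointable A T) :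
    ∃ C, ∀ z : M.Fibre p ⊗[ℂ] M.Fibre q, ‖M.preAmp h T z‖ ≤ C * ‖M.preAmp h 1 z‖ := by
  obtain ⟨T', hT'⟩ := hT
  have hT'' : ∀ x y, (ip (T' x) y : A) = ip x (T y) := fun x y => by
    rw [← star_ip, ← hT', star_ip]
  refine ⟨√‖T'.comp T‖, fun z => ?_⟩
  have h1 := M.norm_preAmp_selfAdjoint h (T'.comp T) (fun x y => by
    rw [ContinuousLinearMap.comp_apply, ContinuousLinearMap.comp_apply, hT'', hT']) z
  have h2 : ‖M.preAmp h T z‖ ^ 2 ≤ ‖M.preAmp h 1 z‖ * ‖M.preAmp h (T'.comp T) z‖ := by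
    rw [norm_sq (A := A), M.ip_preAmp h T 1 T (T'.comp T)]
    · exact norm_ip_le A _ _
    · intro x y
      rw [hT']; rfl
  apply abs_le_of_sq_le_sq' _ (by positivity) |>.2
  rw [mul_pow, Real.sq_sqrt (norm_nonneg _)]
  nlinarith [norm_nonneg (M.preAmp h 1 z)]

/-- The operator `ι_p^r(T)` exists for every adjointable `T`. -/
theorem exists_isAmplification {p q r : S} (h : p * q = r) (hS : ∀ p x y : S, p * x = p * y → x = y)
    (T : M.Fibre p →L[ℂ] M.Fibre p) (hT : IsAdjointable A T) :
    ∃ R : M.Fibre r →L[ℂ] M.Fibre r, M.IsAmplification T R := by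
  have := complete (A := A) (E := M.Fibre r)
  suffices H : ∃ R : M.Fibre r →L[ℂ] M.Fibre r, (∀ x y, R (M.mul h x y) = M.mul h (T x) y) ∧
      ∀ z, (∀ x y, (ip (M.mul h x y) z : A) = 0) → R z = 0 by
    obtain ⟨R, hR⟩ := H
    refine ⟨R, ⟨q, h⟩, fun q' h' => ?_⟩
    obtain rfl := hS p q q' (h.trans h'.symm)
    exact hR
  by_cases hp : p = 1
  · subst hp
    obtain rfl : q = r := by rw [← h, one_mul]
    obtain ⟨T', hT'⟩ := hT
    have hmul : ∀ (x : M.Fibre 1) (y : M.Fibre q), M.mul h x y = lact (M.unit.symm x) y := by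
      intro x y
      rw [← M.unit_mul, M.unit.apply_symm_apply]
    have hTu : ∀ a, M.unit.symm (T (M.unit a)) = M.unit.symm (T (M.unit 1)) * a := by
      intro a
      have hinj : ∀ x y : M.Fibre 1, (∀ z, (ip z x : A) = ip z y) → x = y := by
        intro x y hxy
        rw [← sub_eq_zero, ← norm_eq_zero, ← sq_eq_zero_iff, norm_sq (A := A)]
        have := (ipRight A (x - y)).map_sub x y
        change (ip (x - y) (x - y) : A) = ip (x - y) x - ip (x - y) y at this
        rw [this, hxy, sub_self, norm_zero]
      have : T (M.unit a) = ract (T (M.unit 1)) a := by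
        have hT2 : ∀ x y, (ip x (T y) : A) = ip (T' x) y := fun x y => by
          rw [← star_ip, hT', star_ip]
        refine hinj _ _ fun z => ?_
        rw [ip_ract_right, hT2, hT2, ← ip_ract_right, M.ract_unit, one_mul]
      rw [this, M.unit.symm_apply_eq, ← M.ract_unit, M.unit.apply_symm_apply]
    refine ⟨lact (M.unit.symm (T (M.unit 1))), fun x y => ?_, fun z hz => ?_⟩
    · rw [hmul, hmul, ← lact_mul, ← hTu, M.unit.apply_symm_apply]
    · have h1 : ∀ a : A, lact a z = 0 := by
        intro a
        have := hz (M.unit (star a)) (lact a z)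
        rw [hmul, ContinuousLinearEquiv.symm_apply_apply, ip_lact_left, star_star] at this
        rw [← norm_eq_zero, ← sq_eq_zero_iff, norm_sq (A := A), this, norm_zero]
      exact h1 _
  · have hdense : DenseRange (M.preAmp h 1) := by
      have h1 := Submodule.dense_iff_topologicalClosure_eq_top.2 (M.dense_mul h hp)
      rw [DenseRange, ← LinearMap.coe_range]
      refine h1.mono (SetLike.coe_subset_coe.2 (Submodule.span_le.2 ?_))
      rintro _ ⟨x, y, rfl⟩
      exact ⟨x ⊗ₜ y, M.preAmp_tmul h 1 x y⟩
    have hb := M.norm_preAmp_le h T hT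
    refine ⟨(M.preAmp h T).extendOfNorm (M.preAmp h 1), fun x y => ?_, fun z hz => ?_⟩
    · have := LinearMap.extendOfNorm_eq hdense hb (x ⊗ₜ y)
      rwa [preAmp_tmul, preAmp_tmul] at this
    · have h2 : ∀ w, (ip z w : A) = 0 := by
        intro w
        refine hdense.induction_on (p := fun w => (ip z w : A) = 0) w ?_ ?_
        · exact isClosed_eq (ipRight A z).continuous continuous_const
        · intro t
          induction t with
          | zero => rw [map_zero, ip_zero_right]
          | add a b ha hb => rw [map_add, ip_add_right, ha, hb, add_zero]
          | tmul x y => rw [preAmp_tmul, ← star_ip]; simpa using hz x y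
      have : z = 0 := by
        rw [← norm_eq_zero, ← sq_eq_zero_iff, norm_sq (A := A), h2, norm_zero]
      rw [this, map_zero]

/-- The operator `ι_p^r(T)` is unique. -/
theorem IsAmplification.unique {M : ProductSystem.{u, v, w} A S} {p r : S}
    {T : M.Fibre p →L[ℂ] M.Fibre p} {R R' : M.Fibre r →L[ℂ] M.Fibre r}
    (hR : M.IsAmplification T R) (hR' : M.IsAmplification T R') : R = R' := by
  obtain ⟨⟨q, h⟩, hR⟩ := hR
  obtain ⟨h1, h2⟩ := hR q h
  obtain ⟨h1', h2'⟩ := hR'.2 q h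
  by_cases hp : p = 1
  · subst hp
    obtain rfl : q = r := by rw [← h, one_mul]
    ext z
    have hz : ∀ x y, (ip (M.mul h x y) (z - lact (1 : A) z) : A) = 0 := by
      intro x y
      obtain ⟨a, rfl⟩ := M.unit.surjective x
      have h3 := ip_lact_left (1 : A) (lact a y) z
      rw [star_one, ← lact_mul, one_mul] at h3
      rw [M.unit_mul]
      refine ((ipRight A (lact a y)).map_sub z (lact (1 : A) z)).trans ?_
      exact sub_eq_zero.2 h3
    have e : z = M.mul h (M.unit 1) z + (z - lact (1 : A) z) := by
      rw [M.unit_mul, add_sub_cancel]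
    rw [e, map_add, map_add, h1, h1', h2 _ hz, h2' _ hz]
  · have hd := Submodule.dense_iff_topologicalClosure_eq_top.2 (M.dense_mul h hp)
    refine ContinuousLinearMap.ext_on hd ?_
    rintro _ ⟨x, y, rfl⟩
    rw [h1, h1']

/-- `ι_p^r(T)` is characterised by its defining property. -/
theorem isAmplification_iota {p q r : S} (h : p * q = r) (hS : ∀ p x y : S, p * x = p * y → x = y)
    (T : M.Fibre p →L[ℂ] M.Fibre p) (hT : IsAdjointable A T) :
    M.IsAmplification T (M.iota p r T) := by
  have hex := M.exists_isAmplification h hS T hT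
  rw [iota, dif_pos hex]
  exact hex.choose_spec

end Amplification

end CStarProductSystem.ProductSystem

namespace CStarProductSystem

universe u v w

open UniformSpace RightHilbertBimodule

section Extension

variable {V W F : Type*} [SeminormedAddCommGroup V] [NormedSpace ℂ V] [SeminormedAddCommGroup W]
  [NormedSpace ℂ W] [NormedAddCommGroup F] [NormedSpace ℂ F] [CompleteSpace F] {σ : ℂ →+* ℂ}
  [RingHomIsometric σ]

/-- Extension of a bounded sesquilinear or bilinear map to the completions. -/
noncomputable def extend₂ (f : V →SL[σ] W →L[ℂ] F) :
    Completion V →SL[σ] Completion W →L[ℂ] F :=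
  (f.fromCompletion.flip.fromCompletion).flip

theorem extend₂_coe (f : V →SL[σ] W →L[ℂ] F) (x : V) (y : W) :
    extend₂ f (x : Completion V) (y : Completion W) = f x y := by
  simp [extend₂]

end Extension

/-- Exel-Larsen systems with unital C⋆-algebra: an action `α` of `P` by unital endomorphisms and an
action `L` of the opposite semigroup by unital positive transfer operators. -/
structure ExelLarsenSystem (A : Type u) (P : Type v) [CStarAlgebra A] [Monoid P] where
  α : P → (A →⋆ₐ[ℂ] A)
  L : P → (A →L[ℂ] A)
  α_one : ∀ a, α 1 a = a
  α_mul : ∀ p q a, α (p * q) a = α p (α q a)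
  L_one : ∀ a, L 1 a = a
  L_mul : ∀ p q a, L (p * q) a = L q (L p a)
  L_unital : ∀ p, L p 1 = 1
  L_star : ∀ p a, L p (star a) = star (L p a)
  L_pos : ∀ p a, ∃ b, L p (star a * a) = star b * b
  transfer : ∀ p a b, L p (α p a * b) = a * L p b

namespace ExelLarsenSystem

variable {A : Type u} {P : Type v} [CStarAlgebra A] [Monoid P] (X : ExelLarsenSystem A P)

theorem transfer' (p : P) (a b : A) : X.L p (b * X.α p a) = X.L p b * a := by
  have := congrArg star (X.transfer p (star a) (star b))
  rwa [← X.L_star, star_mul, star_star, map_star, star_star, X.L_star, star_mul, star_star,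
    star_star] at this

/-- The `A`-valued semi-inner product `⟨a, b⟩_p = L_p(a⋆ b)` on `A`. -/
noncomputable def preInner (p : P) : SemiInner A A where
  ip a b := X.L p (star a * b)
  add_right x y z := by rw [mul_add, map_add]
  smul_right c x y := by rw [mul_smul_comm, map_smul]
  star_ip x y := by rw [← X.L_star, star_mul, star_star]
  pos x := X.L_pos p x
  act x y := ⟨x * X.α p (X.L p (star x * y)), fun w => by rw [← mul_assoc, X.transfer']⟩

/-- The vector space `A`, to be equipped with the seminorm of `⟨·, ·⟩_p`. -/
def PreFibre (_ : ExelLarsenSystem A P) (_ : P) : Type u := A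

noncomputable instance (p : P) : AddCommGroup (X.PreFibre p) := inferInstanceAs (AddCommGroup A)

noncomputable instance (p : P) : Module ℂ (X.PreFibre p) := inferInstanceAs (Module ℂ A)

noncomputable instance (p : P) : SeminormedAddCommGroup (X.PreFibre p) :=
  AddGroupSeminorm.toSeminormedAddCommGroup (E := X.PreFibre p)
    (X.preInner p).seminorm.toAddGroupSeminorm

/-- The identity map from `A` to the vector space `A` with the seminorm of `⟨·, ·⟩_p`. -/
noncomputable def toPre (p : P) : A ≃ₗ[ℂ] X.PreFibre p := LinearEquiv.refl ℂ A

theorem norm_toPre (p : P) (a : A) : ‖X.toPre p a‖ = √‖X.L p (star a * a)‖ := rfl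

theorem norm_toPre_sq (p : P) (a : A) : ‖X.toPre p a‖ ^ 2 = ‖X.L p (star a * a)‖ := by
  rw [norm_toPre, Real.sq_sqrt (norm_nonneg _)]

noncomputable instance (p : P) : NormedSpace ℂ (X.PreFibre p) where
  norm_smul_le c x := (map_smul_eq_mul (X.preInner p).seminorm c x).le

theorem L_mono (p : P) (a b : A) :
    ‖X.L p (star b * (star a * a) * b)‖ ≤ ‖star a * a‖ * ‖X.L p (star b * b)‖ := by
  let _ := CStarAlgebra.spectralOrder A
  let _ := CStarAlgebra.spectralOrderedRing A
  have h0 : ∀ x : A, 0 ≤ x → 0 ≤ X.L p x := fun x hx => by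
    obtain ⟨y, rfl⟩ := CStarAlgebra.nonneg_iff_eq_star_mul_self.1 hx
    obtain ⟨z, hz⟩ := X.L_pos p y
    rw [hz]; exact star_mul_self_nonneg z
  have h1 : star b * (star a * a) * b ≤ ‖star a * a‖ • (star b * b) :=
    CStarAlgebra.star_left_conjugate_le_norm_smul
  have h2 := h0 _ (sub_nonneg.2 h1)
  rw [map_sub, sub_nonneg, (X.L p).map_smul_of_tower] at h2
  have h3 := CStarAlgebra.norm_le_norm_of_nonneg_of_le
    (h0 _ (by simpa [mul_assoc] using star_mul_self_nonneg (a * b))) h2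
  rwa [norm_smul, norm_norm] at h3

theorem norm_lmul (p : P) (a b : A) : ‖X.toPre p (a * b)‖ ≤ ‖a‖ * ‖X.toPre p b‖ := by
  apply abs_le_of_sq_le_sq' _ (by positivity) |>.2
  rw [mul_pow, norm_toPre_sq, norm_toPre_sq, sq ‖a‖, ← CStarRing.norm_star_mul_self]
  simpa [mul_assoc] using X.L_mono p a b

theorem norm_mul {p q r : P} (h : p * q = r) (a b : A) :
    ‖X.toPre r (a * X.α p b)‖ ≤ ‖X.toPre p a‖ * ‖X.toPre q b‖ := by
  subst h
  apply abs_le_of_sq_le_sq' _ (by positivity) |>.2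
  rw [mul_pow, norm_toPre_sq, norm_toPre_sq, norm_toPre_sq]
  obtain ⟨c, hc⟩ := X.L_pos p a
  have h1 : X.L (p * q) (star (a * X.α p b) * (a * X.α p b))
      = X.L q (star b * (star c * c) * b) := by
    rw [X.L_mul, ← hc, star_mul, ← map_star, ← X.transfer, ← X.transfer']
    simp only [mul_assoc]
  rw [h1, hc]
  exact X.L_mono q c b

theorem norm_rmul (p : P) (a b : A) :
    ‖X.toPre p (a * X.α p b)‖ ≤ ‖X.toPre p a‖ * ‖b‖ := by
  have h := X.norm_mul (mul_one p) a b
  rwa [X.norm_toPre 1 b, X.L_one, CStarRing.norm_star_mul_self, Real.sqrt_mul_self (norm_nonneg _)]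
    at h

/-- The Hilbert module `M_p`: the Hausdorff completion of `A` with respect to `⟨·, ·⟩_p`. -/
abbrev Fibre (p : P) : Type u := Completion (X.PreFibre p)

/-- The map `π_p : A → M_p` with dense range. -/
noncomputable def pi (p : P) : A →ₗ[ℂ] X.Fibre p :=
  (Completion.toComplL (𝕜 := ℂ)).toLinearMap ∘ₗ (X.toPre p).toLinearMap

theorem pi_apply (p : P) (a : A) : X.pi p a = ((X.toPre p a : X.PreFibre p) : X.Fibre p) := rfl

theorem denseRange_pi (p : P) : DenseRange (X.pi p) :=
  Completion.denseRange_coe (α := X.PreFibre p)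

/-- The inner product before completion. -/
noncomputable def ip₀ (p : P) : X.PreFibre p →L⋆[ℂ] X.PreFibre p →L[ℂ] A :=
  LinearMap.mkContinuous₂
    (LinearMap.mk₂'ₛₗ (starRingEnd ℂ) (RingHom.id ℂ)
      (fun x y => X.L p (star ((X.toPre p).symm x) * (X.toPre p).symm y))
      (fun x y z => by rw [map_add, star_add, add_mul, map_add])
      (fun c x z => by rw [map_smul, star_smul, smul_mul_assoc, map_smul]; rfl)
      (fun x y z => by rw [map_add, mul_add, map_add])
      (fun c x z => by rw [map_smul, mul_smul_comm, map_smul]; rfl)) 1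
    (fun x y => by
      rw [one_mul]
      exact (X.preInner p).norm_ip_le x y)

/-- The right action `a · b = a α_p(b)` before completion. -/
noncomputable def ract₀ (p : P) : X.PreFibre p →L[ℂ] A →L[ℂ] X.Fibre p :=
  LinearMap.mkContinuous₂
    (LinearMap.mk₂ ℂ (fun x a => X.pi p ((X.toPre p).symm x * X.α p a))
      (fun x y z => by rw [map_add, add_mul, map_add])
      (fun c x z => by rw [map_smul, smul_mul_assoc, map_smul])
      (fun x y z => by rw [map_add, mul_add, map_add])
      (fun c x z => by rw [map_smul, mul_smul_comm, map_smul])) 1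
    (fun x y => by
      rw [one_mul]
      obtain ⟨a, rfl⟩ := (X.toPre _).surjective x
      exact (Completion.norm_coe _).le.trans (X.norm_rmul p a y))

/-- The left action `a b` before completion. -/
noncomputable def lact₀ (p : P) : A →L[ℂ] X.PreFibre p →L[ℂ] X.Fibre p :=
  LinearMap.mkContinuous₂
    (LinearMap.mk₂ ℂ (fun a x => X.pi p (a * (X.toPre p).symm x))
      (fun x y z => by rw [add_mul, map_add])
      (fun c x z => by rw [smul_mul_assoc, map_smul])
      (fun x y z => by rw [map_add, mul_add, map_add])
      (fun c x z => by rw [map_smul, mul_smul_comm, map_smul])) 1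
    (fun x y => by
      rw [one_mul]
      obtain ⟨a, rfl⟩ := (X.toPre _).surjective y
      exact (Completion.norm_coe _).le.trans (X.norm_lmul p x a))

/-- The product `a α_p(b)` before completion. -/
noncomputable def mul₀ {p q r : P} (h : p * q = r) :
    X.PreFibre p →L[ℂ] X.PreFibre q →L[ℂ] X.Fibre r :=
  LinearMap.mkContinuous₂
    (LinearMap.mk₂ ℂ (fun x y => X.pi r ((X.toPre p).symm x * X.α p ((X.toPre q).symm y)))
      (fun x y z => by rw [map_add, add_mul, map_add])
      (fun c x z => by rw [map_smul, smul_mul_assoc, map_smul])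
      (fun x y z => by rw [map_add, map_add, mul_add, map_add])
      (fun c x z => by rw [map_smul, map_smul, mul_smul_comm, map_smul])) 1
    (fun x y => by
      rw [one_mul]
      obtain ⟨a, rfl⟩ := (X.toPre _).surjective x
      obtain ⟨b, rfl⟩ := (X.toPre _).surjective y
      exact (Completion.norm_coe _).le.trans (X.norm_mul h a b))

/-- The inner product of `M_p`. -/
noncomputable def ipC (p : P) : X.Fibre p →L⋆[ℂ] X.Fibre p →L[ℂ] A := extend₂ (X.ip₀ p)

/-- The right action on `M_p`. -/
noncomputable def ractC (p : P) : X.Fibre p →L[ℂ] A →L[ℂ] X.Fibre p :=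
  (X.ract₀ p).fromCompletion

/-- The left action on `M_p`. -/
noncomputable def lactC (p : P) : A →L[ℂ] X.Fibre p →L[ℂ] X.Fibre p :=
  (X.lact₀ p).flip.fromCompletion.flip

/-- The product `M_p × M_q → M_{pq}`. -/
noncomputable def mulC {p q r : P} (h : p * q = r) : X.Fibre p →L[ℂ] X.Fibre q →L[ℂ] X.Fibre r :=
  extend₂ (X.mul₀ h)

theorem ipC_pi (p : P) (a b : A) : X.ipC p (X.pi p a) (X.pi p b) = X.L p (star a * b) :=
  extend₂_coe (X.ip₀ p) (X.toPre p a) (X.toPre p b)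

theorem ractC_pi (p : P) (a b : A) : X.ractC p (X.pi p a) b = X.pi p (a * X.α p b) := by
  rw [ractC, pi_apply, ContinuousLinearMap.fromCompletion_apply_coe]
  rfl

theorem lactC_pi (p : P) (a b : A) : X.lactC p a (X.pi p b) = X.pi p (a * b) := by
  rw [lactC, pi_apply, ContinuousLinearMap.flip_apply,
    ContinuousLinearMap.fromCompletion_apply_coe]
  rfl

theorem mulC_pi {p q r : P} (h : p * q = r) (a b : A) :
    X.mulC h (X.pi p a) (X.pi q b) = X.pi r (a * X.α p b) :=
  extend₂_coe (X.mul₀ h) (X.toPre p a) (X.toPre q b)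

theorem fibre_ind {p : P} {motive : X.Fibre p → Prop} (hc : IsClosed {x | motive x})
    (h : ∀ a, motive (X.pi p a)) (x : X.Fibre p) : motive x :=
  Completion.induction_on x hc h

theorem isClosed_pos : IsClosed {x : A | ∃ b, x = star b * b} := by
  let _ := CStarAlgebra.spectralOrder A
  let _ := CStarAlgebra.spectralOrderedRing A
  have : {x : A | ∃ b, x = star b * b} = {x | 0 ≤ x} := by
    ext x
    exact CStarAlgebra.nonneg_iff_eq_star_mul_self.symm
  rw [this]
  exact CStarAlgebra.isClosed_nonneg

/-- The right-Hilbert bimodule `M_p`. -/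
noncomputable instance bimodule (p : P) : RightHilbertBimodule A (X.Fibre p) where
  complete := inferInstance
  ip x y := X.ipC p x y
  ract := X.ractC p
  lact := X.lactC p
  ract_one x := by
    induction x using X.fibre_ind with
    | hc => exact isClosed_eq (by fun_prop) (by fun_prop)
    | h a => ?_
    rw [ractC_pi, map_one, mul_one]
  ract_mul x a b := by
    induction x using X.fibre_ind with
    | hc => exact isClosed_eq (by fun_prop) (by fun_prop)
    | h c => ?_
    rw [ractC_pi, ractC_pi, ractC_pi, map_mul (X.α p), mul_assoc]
  ip_add_right x y z := map_add _ _ _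
  ip_smul_right c x y := map_smul _ _ _
  ip_ract_right x y a := by
    induction x using X.fibre_ind with
    | hc => exact isClosed_eq (by fun_prop) (by fun_prop)
    | h b => ?_
    induction y using X.fibre_ind with
    | hc => exact isClosed_eq (by fun_prop) (by fun_prop)
    | h c => ?_
    rw [ractC_pi, ipC_pi, ipC_pi, ← mul_assoc, X.transfer']
  star_ip x y := by
    induction x using X.fibre_ind with
    | hc => exact isClosed_eq (by fun_prop) (by fun_prop)
    | h b => ?_
    induction y using X.fibre_ind with
    | hc => exact isClosed_eq (by fun_prop) (by fun_prop)
    | h c => ?_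
    rw [ipC_pi, ipC_pi, ← X.L_star, star_mul, star_star]
  ip_self_pos x := by
    refine X.fibre_ind (motive := fun x => ∃ b, X.ipC p x x = star b * b)
      (isClosed_pos.preimage (f := fun x => X.ipC p x x) (by fun_prop)) (fun b => ?_) x
    rw [ipC_pi]
    exact X.L_pos p b
  norm_sq x := by
    induction x using X.fibre_ind with
    | hc => exact isClosed_eq (by fun_prop) (by fun_prop)
    | h b => ?_
    rw [ipC_pi, ← norm_toPre_sq, pi_apply, Completion.norm_coe]
  lact_mul a b x := by
    induction x using X.fibre_ind with
    | hc => exact isClosed_eq (by fun_prop) (by fun_prop)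
    | h c => ?_
    rw [lactC_pi, lactC_pi, lactC_pi, mul_assoc]
  ip_lact_left a x y := by
    induction x using X.fibre_ind with
    | hc => exact isClosed_eq (by fun_prop) (by fun_prop)
    | h b => ?_
    induction y using X.fibre_ind with
    | hc => exact isClosed_eq (by fun_prop) (by fun_prop)
    | h c => ?_
    rw [lactC_pi, lactC_pi, ipC_pi, ipC_pi, star_mul, mul_assoc]

theorem ip_pi (p : P) (a b : A) : (ip (X.pi p a) (X.pi p b) : A) = X.L p (star a * b) :=
  X.ipC_pi p a b

/-- `π_1` identifies `A` with `M_1`. -/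
noncomputable def unit₁ : A ≃L[ℂ] X.Fibre 1 :=
  let f : A →ₗᵢ[ℂ] X.Fibre 1 :=
    { X.pi 1 with
      norm_map' := fun a => by
        show ‖X.pi 1 a‖ = ‖a‖
        rw [pi_apply, Completion.norm_coe, norm_toPre, X.L_one, CStarRing.norm_star_mul_self,
          Real.sqrt_mul_self (norm_nonneg _)] }
  (LinearIsometryEquiv.ofSurjective f (by
    have h1 : IsClosed (Set.range f) := f.isometry.isClosedEmbedding.isClosed_range
    have h2 : DenseRange f := X.denseRange_pi 1
    intro x
    have := h2 x
    rwa [h1.closure_eq] at this)).toContinuousLinearEquiv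

theorem unit₁_apply (a : A) : X.unit₁ a = X.pi 1 a := rfl

/-- The product system of an Exel-Larsen system: the fibre `M_p` is the Hausdorff completion of `A`
for the inner product `L_p(a⋆ b)`, with actions `b a` and `a α_p(b)`, and the product is given
by `π_p(a) π_q(b) = π_{pq}(a α_p(b))`. -/
noncomputable def productSystem : ProductSystem.{u, v, u} A P where
  Fibre := X.Fibre
  mul h := X.mulC h
  assoc h₁ h₂ h₃ h₄ x y z := by
    induction x using X.fibre_ind with
    | hc => exact isClosed_eq (by fun_prop) (by fun_prop)
    | h a => ?_
    induction y using X.fibre_ind with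
    | hc => exact isClosed_eq (by fun_prop) (by fun_prop)
    | h b => ?_
    induction z using X.fibre_ind with
    | hc => exact isClosed_eq (by fun_prop) (by fun_prop)
    | h c => ?_
    rw [mulC_pi, mulC_pi, mulC_pi, mulC_pi, ← h₁, X.α_mul, map_mul (X.α _), mul_assoc]
  ip_mul {p q r} h x x' y y' := by
    show X.ipC r (X.mulC h x y) (X.mulC h x' y') = X.ipC q y (X.lactC q (X.ipC p x x') y')
    induction x using X.fibre_ind with
    | hc => exact isClosed_eq (by fun_prop) (by fun_prop)
    | h a => ?_
    induction x' using X.fibre_ind with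
    | hc => exact isClosed_eq (by fun_prop) (by fun_prop)
    | h a' => ?_
    induction y using X.fibre_ind with
    | hc => exact isClosed_eq (by fun_prop) (by fun_prop)
    | h b => ?_
    induction y' using X.fibre_ind with
    | hc => exact isClosed_eq (by fun_prop) (by fun_prop)
    | h b' => ?_
    rw [mulC_pi, mulC_pi, ipC_pi, ipC_pi, lactC_pi, ipC_pi, ← h, X.L_mul, star_mul, ← map_star,
      ← X.transfer', ← X.transfer]
    simp only [mul_assoc]
  dense_mul {p q r} h _ := by
    rw [← Submodule.dense_iff_topologicalClosure_eq_top]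
    refine (X.denseRange_pi r).mono ?_
    rintro _ ⟨a, rfl⟩
    refine Submodule.subset_span ⟨X.pi p a, X.pi q 1, ?_⟩
    rw [mulC_pi, map_one, mul_one]
  unit := X.unit₁
  ip_unit a b := by
    rw [unit₁_apply, unit₁_apply, ip_pi, X.L_one]
  ract_unit a b := by
    rw [unit₁_apply, unit₁_apply]
    exact (X.ractC_pi 1 a b).trans (by rw [X.α_one])
  lact_unit a b := X.lactC_pi 1 b a
  unit_mul p a x := by
    show X.mulC _ (X.unit₁ a) x = X.lactC p a x
    induction x using X.fibre_ind with
    | hc => exact isClosed_eq (by fun_prop) (by fun_prop)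
    | h b => ?_
    rw [unit₁_apply, mulC_pi, lactC_pi, X.α_one]
  mul_unit p x a := by
    show X.mulC _ x (X.unit₁ a) = X.ractC p x a
    induction x using X.fibre_ind with
    | hc => exact isClosed_eq (by fun_prop) (by fun_prop)
    | h b => ?_
    rw [unit₁_apply, mulC_pi, ractC_pi]

end ExelLarsenSystem

end CStarProductSystem

namespace CStarProductSystem

universe u v w

open UniformSpace ComplexConjugate

/-! ### The full group C⋆-algebra -/

/-- The complex group algebra of a discrete group. -/
def GroupAlg (G : Type u) [Group G] : Type u := MonoidAlgebra ℂ G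

namespace GroupAlg

variable {G : Type u} [Group G]

noncomputable instance : Ring (GroupAlg G) := inferInstanceAs (Ring (MonoidAlgebra ℂ G))

noncomputable instance : Algebra ℂ (GroupAlg G) :=
  inferInstanceAs (Algebra ℂ (MonoidAlgebra ℂ G))

/-- The canonical basis `δ_g`. -/
noncomputable def delta (g : G) : GroupAlg G := MonoidAlgebra.single g 1

theorem induction {motive : GroupAlg G → Prop} (zero : motive 0)
    (add : ∀ x y, motive x → motive y → motive (x + y))
    (single : ∀ g (c : ℂ), motive (c • delta g)) (x : GroupAlg G) : motive x := by
  refine MonoidAlgebra.induction_linear (motive := motive) x zero add fun g c => ?_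
  have e : c • delta g = (MonoidAlgebra.single g c : MonoidAlgebra ℂ G) :=
    (MonoidAlgebra.smul_single c g (1 : ℂ)).trans (by rw [smul_eq_mul, mul_one])
  exact e ▸ single g c

theorem delta_mul (g h : G) : delta g * delta h = delta (g * h) :=
  (MonoidAlgebra.single_mul_single g h (1 : ℂ) 1).trans (by rw [mul_one]; rfl)

theorem delta_one : delta (1 : G) = 1 := rfl

/-- The involution `(∑ c_g δ_g)⋆ = ∑ conj c_g δ_{g⁻¹}`. -/
noncomputable def starFun : GroupAlg G →ₗ⋆[ℂ] GroupAlg G where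
  toFun f := MonoidAlgebra.ofCoeff
    (Finsupp.equivMapDomain (Equiv.inv G) (f.coeff.mapRange (starRingEnd ℂ) (map_zero _)))
  map_add' x y := by
    apply MonoidAlgebra.ext
    ext g
    exact map_add (starRingEnd ℂ) _ _
  map_smul' c x := by
    apply MonoidAlgebra.ext
    ext g
    exact map_mul (starRingEnd ℂ) _ _

theorem starFun_delta (g : G) : starFun (delta g) = delta g⁻¹ := by
  apply MonoidAlgebra.ext
  show Finsupp.equivMapDomain (Equiv.inv G) ((Finsupp.single g 1).mapRange (starRingEnd ℂ) _) =
    Finsupp.single g⁻¹ 1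
  rw [Finsupp.mapRange_single, Finsupp.equivMapDomain_single, map_one]
  rfl

noncomputable instance : StarRing (GroupAlg G) where
  star := starFun
  star_involutive x := by
    show starFun (starFun x) = x
    induction x using induction with
    | zero => simp
    | add x y hx hy => rw [map_add, map_add, hx, hy]
    | single g c =>
      rw [map_smulₛₗ, map_smulₛₗ, starFun_delta, starFun_delta, inv_inv, Complex.conj_conj]
  star_add := map_add starFun
  star_mul x y := by
    show starFun (x * y) = starFun y * starFun x
    induction x using induction with
    | zero => simp
    | add x z hx hz => rw [add_mul, map_add, hx, hz, map_add, mul_add]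
    | single g c =>
      induction y using induction with
      | zero => simp
      | add x z hx hz => rw [mul_add, map_add, hx, hz, map_add, add_mul]
      | single h d =>
        rw [smul_mul_smul_comm, delta_mul, map_smulₛₗ, map_smulₛₗ, map_smulₛₗ, starFun_delta,
          starFun_delta, starFun_delta, smul_mul_smul_comm, delta_mul, mul_inv_rev, map_mul,
          mul_comm (conj c)]

instance : StarModule ℂ (GroupAlg G) where
  star_smul c x := map_smulₛₗ starFun c x

theorem star_delta (g : G) : star (delta g) = delta g⁻¹ := starFun_delta g

/-- A C⋆-seminorm on the group algebra. -/
structure IsCStarSeminorm (p : Seminorm ℂ (GroupAlg G)) : Prop where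
  mul_le : ∀ x y, p (x * y) ≤ p x * p y
  star_mul_self : ∀ x, p (star x * x) = p x ^ 2

theorem IsCStarSeminorm.bound (x : GroupAlg G) :
    ∃ C, ∀ p : Seminorm ℂ (GroupAlg G), IsCStarSeminorm p → p x ≤ C := by
  induction x using induction with
  | zero => exact ⟨0, fun p _ => (map_zero p).le⟩
  | add x y hx hy =>
    obtain ⟨C, hC⟩ := hx
    obtain ⟨D, hD⟩ := hy
    exact ⟨C + D, fun p hp => (map_add_le_add p x y).trans (add_le_add (hC p hp) (hD p hp))⟩
  | single g c =>
    refine ⟨‖c‖, fun p hp => ?_⟩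
    have h0 : p 1 ≤ 1 := by
      have := hp.star_mul_self 1
      rw [star_one, mul_one] at this
      nlinarith [apply_nonneg p 1]
    have h1 : p (delta g) ≤ 1 := by
      have := hp.star_mul_self (delta g)
      rw [star_delta, delta_mul, inv_mul_cancel, delta_one] at this
      nlinarith [apply_nonneg p (delta g)]
    rw [map_smul_eq_mul]
    exact mul_le_of_le_one_right (norm_nonneg _) h1

theorem isCStarSeminorm_zero : IsCStarSeminorm (0 : Seminorm ℂ (GroupAlg G)) :=
  ⟨fun _ _ => by simp, fun _ => by simp⟩

/-- The largest C⋆-seminorm on the group algebra. -/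
noncomputable def maxNorm (x : GroupAlg G) : ℝ :=
  ⨆ p : {p : Seminorm ℂ (GroupAlg G) // IsCStarSeminorm p}, p.1 x

instance : Nonempty {p : Seminorm ℂ (GroupAlg G) // IsCStarSeminorm p} :=
  ⟨⟨0, isCStarSeminorm_zero⟩⟩

theorem le_maxNorm {p : Seminorm ℂ (GroupAlg G)} (hp : IsCStarSeminorm p) (x : GroupAlg G) :
    p x ≤ maxNorm x := by
  obtain ⟨C, hC⟩ := IsCStarSeminorm.bound x
  exact le_ciSup (f := fun p : {p : Seminorm ℂ (GroupAlg G) // IsCStarSeminorm p} => p.1 x)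
    ⟨C, by rintro _ ⟨p, rfl⟩; exact hC p.1 p.2⟩ ⟨p, hp⟩

theorem maxNorm_le {x : GroupAlg G} {C : ℝ} (h : ∀ p, IsCStarSeminorm p → p x ≤ C) :
    maxNorm x ≤ C := ciSup_le fun p => h p.1 p.2

theorem maxNorm_nonneg (x : GroupAlg G) : 0 ≤ maxNorm x := by
  have := le_maxNorm isCStarSeminorm_zero x
  simpa using this

theorem IsCStarSeminorm.star {p : Seminorm ℂ (GroupAlg G)} (hp : IsCStarSeminorm p)
    (x : GroupAlg G) : p (star x) = p x := by
  have key : ∀ x : GroupAlg G, p x ≤ p (Star.star x) := fun x => by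
    have h1 := hp.star_mul_self x
    have h2 := hp.mul_le (Star.star x) x
    rw [h1] at h2
    by_contra h
    push Not at h
    nlinarith [apply_nonneg p (Star.star x)]
  refine le_antisymm ?_ (key x)
  simpa using key (Star.star x)

/-- The largest C⋆-seminorm, as a ring seminorm. -/
noncomputable def maxRingSeminorm : RingSeminorm (GroupAlg G) where
  toFun := maxNorm
  map_zero' := le_antisymm (maxNorm_le fun p _ => (map_zero p).le) (maxNorm_nonneg _)
  add_le' x y := maxNorm_le fun p hp =>
    (map_add_le_add p x y).trans (add_le_add (le_maxNorm hp x) (le_maxNorm hp y))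
  neg' x := by simp [maxNorm, map_neg_eq_map]
  mul_le' x y := maxNorm_le fun p hp => (hp.mul_le x y).trans
    (mul_le_mul (le_maxNorm hp x) (le_maxNorm hp y) (apply_nonneg _ _) (maxNorm_nonneg x))

noncomputable instance : SeminormedRing (GroupAlg G) := maxRingSeminorm.toSeminormedRing

theorem norm_def (x : GroupAlg G) : ‖x‖ = maxNorm x := rfl

noncomputable instance : NormedSpace ℂ (GroupAlg G) where
  norm_smul_le c x := maxNorm_le fun p hp => by
    rw [map_smul_eq_mul]
    exact mul_le_mul_of_nonneg_left (le_maxNorm hp x) (norm_nonneg c)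

theorem norm_star_eq (x : GroupAlg G) : ‖star x‖ = ‖x‖ := by
  have : ∀ x : GroupAlg G, ‖star x‖ ≤ ‖x‖ := fun x => maxNorm_le fun p hp => by
    rw [hp.star]; exact le_maxNorm hp x
  refine le_antisymm (this x) ?_
  simpa using this (star x)

theorem norm_sq_le (x : GroupAlg G) : ‖x‖ * ‖x‖ ≤ ‖star x * x‖ := by
  have h : ‖x‖ ≤ √‖star x * x‖ := maxNorm_le fun p hp => by
    apply Real.le_sqrt_of_sq_le
    rw [← hp.star_mul_self]
    exact le_maxNorm hp _
  calc _ ≤ √‖star x * x‖ * √‖star x * x‖ := by gcongr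
    _ = _ := Real.mul_self_sqrt (norm_nonneg _)

theorem norm_delta_le (g : G) : ‖delta g‖ ≤ 1 := maxNorm_le fun p hp => by
  have h0 : p 1 ≤ 1 := by
    have := hp.star_mul_self 1
    rw [star_one, mul_one] at this
    nlinarith [apply_nonneg p 1]
  have := hp.star_mul_self (delta g)
  rw [star_delta, delta_mul, inv_mul_cancel, delta_one] at this
  nlinarith [apply_nonneg p (delta g)]

/-- The involution as a bounded conjugate-linear map. -/
noncomputable def starL : GroupAlg G →L⋆[ℂ] GroupAlg G :=
  starFun.mkContinuous 1 fun x => by rw [one_mul]; exact (norm_star_eq x).le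

end GroupAlg

/-- The full group C⋆-algebra `C⋆(G)` of a discrete group: the Hausdorff completion of the complex
group algebra with respect to its largest C⋆-seminorm. -/
abbrev GroupCStar (G : Type u) [Group G] : Type u := Completion (GroupAlg G)

namespace GroupCStar

variable {G : Type u} [Group G]

/-- The canonical homomorphism from the group algebra to `C⋆(G)`. -/
noncomputable def incl : GroupAlg G →L[ℂ] GroupCStar G := Completion.toComplL

theorem incl_mul (x y : GroupAlg G) : incl (x * y) = incl x * incl y := Completion.coe_mul x y

theorem norm_incl (x : GroupAlg G) : ‖incl x‖ = ‖x‖ := Completion.norm_coe x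

/-- The canonical unitaries `δ_g ∈ C⋆(G)`. -/
noncomputable def δ (g : G) : GroupCStar G := incl (GroupAlg.delta g)

theorem ind {motive : GroupCStar G → Prop} (hc : IsClosed {x | motive x})
    (h : ∀ a, motive (incl a)) (x : GroupCStar G) : motive x :=
  Completion.induction_on x hc h

/-- The involution of `C⋆(G)`. -/
noncomputable def starC : GroupCStar G →L⋆[ℂ] GroupCStar G := GroupAlg.starL.completion

theorem starC_incl (x : GroupAlg G) : starC (incl x) = incl (star x) :=
  GroupAlg.starL.completion_apply_coe x

noncomputable instance : StarRing (GroupCStar G) where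
  star := starC
  star_involutive x := by
    show starC (starC x) = x
    induction x using ind with
    | hc => exact isClosed_eq (by fun_prop) (by fun_prop)
    | h x => rw [starC_incl, starC_incl, star_star]
  star_add := map_add starC
  star_mul x y := by
    show starC (x * y) = starC y * starC x
    induction x using ind with
    | hc => exact isClosed_eq (by fun_prop) (by fun_prop)
    | h x =>
    induction y using ind with
    | hc => exact isClosed_eq (by fun_prop) (by fun_prop)
    | h y => rw [← incl_mul, starC_incl, starC_incl, starC_incl, star_mul, incl_mul]

theorem star_incl (x : GroupAlg G) : star (incl x) = incl (star x) := starC_incl x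

instance : StarModule ℂ (GroupCStar G) where
  star_smul c x := map_smulₛₗ starC c x

instance : CStarRing (GroupCStar G) where
  norm_mul_self_le x := by
    show ‖x‖ * ‖x‖ ≤ ‖starC x * x‖
    induction x using ind with
    | hc => exact isClosed_le (by fun_prop) (by fun_prop)
    | h x =>
      rw [starC_incl, ← incl_mul, norm_incl, norm_incl]
      exact GroupAlg.norm_sq_le x

noncomputable instance : NormedAlgebra ℂ (GroupCStar G) where
  __ := (inferInstance : Algebra ℂ (GroupCStar G))
  norm_smul_le := norm_smul_le

noncomputable instance : CStarAlgebra (GroupCStar G) where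

end GroupCStar

end CStarProductSystem

namespace CStarProductSystem

universe u v w

open UniformSpace

namespace GroupAlg

variable {G H K : Type u} [Group G] [Group H] [Group K] (θ : H →* G)

/-- The homomorphism `δ_h ↦ δ_{θ(h)}` of group algebras. -/
noncomputable def emb : GroupAlg H →ₐ[ℂ] GroupAlg G := MonoidAlgebra.mapDomainAlgHom ℂ ℂ θ

theorem emb_delta (h : H) : emb θ (delta h) = delta (θ h) := by
  apply MonoidAlgebra.ext
  exact Finsupp.mapDomain_single

theorem emb_star (x : GroupAlg H) : emb θ (star x) = star (emb θ x) := by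
  induction x using induction with
  | zero => simp
  | add x y hx hy => rw [star_add, map_add, hx, hy, map_add, star_add]
  | single g c =>
    rw [star_smul, star_delta, map_smul, map_smul, star_smul, emb_delta, emb_delta, star_delta,
      map_inv]

theorem norm_emb_le (x : GroupAlg H) : ‖emb θ x‖ ≤ ‖x‖ := maxNorm_le fun p hp =>
  le_maxNorm (p := p.comp (emb θ).toLinearMap)
    ⟨fun x y => by simpa using hp.mul_le _ _, fun x => by
      simpa [emb_star] using hp.star_mul_self (emb θ x)⟩ x

/-- The map `δ_g ↦ δ_h` if `g = θ(h)`, and `δ_g ↦ 0` if `g` is not in the range of `θ`. -/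
noncomputable def res (hθ : Function.Injective θ) : GroupAlg G →ₗ[ℂ] GroupAlg H where
  toFun x := MonoidAlgebra.ofCoeff (x.coeff.comapDomain θ hθ.injOn)
  map_add' x y := by
    apply MonoidAlgebra.ext
    ext g
    rfl
  map_smul' c x := by
    apply MonoidAlgebra.ext
    ext g
    rfl

variable {θ} (hθ : Function.Injective θ)

theorem res_delta (h : H) : res θ hθ (delta (θ h)) = delta h := by
  apply MonoidAlgebra.ext
  ext k
  show (Finsupp.single (θ h) (1 : ℂ)) (θ k) = Finsupp.single h (1 : ℂ) k
  classical
  rw [Finsupp.single_apply, Finsupp.single_apply, hθ.eq_iff]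

theorem res_delta_of_notMem {g : G} (hg : g ∉ Set.range θ) : res θ hθ (delta g) = 0 := by
  apply MonoidAlgebra.ext
  ext h
  show (Finsupp.single g (1 : ℂ)) (θ h) = 0
  rw [Finsupp.single_eq_of_ne]
  rintro rfl
  exact hg ⟨h, rfl⟩

theorem res_emb_mul (x : GroupAlg H) (y : GroupAlg G) :
    res θ hθ (emb θ x * y) = x * res θ hθ y := by
  induction x using induction with
  | zero => simp
  | add x z hx hz => rw [map_add, add_mul, map_add, hx, hz, add_mul]
  | single h c =>
    rw [map_smul, smul_mul_assoc, map_smul, smul_mul_assoc, emb_delta]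
    congr 1
    induction y using induction with
    | zero => simp
    | add x z hx hz => rw [mul_add, map_add, hx, hz, map_add, mul_add]
    | single g d =>
      rw [mul_smul_comm, map_smul, map_smul, mul_smul_comm, delta_mul]
      congr 1
      by_cases hg : g ∈ Set.range θ
      · obtain ⟨k, rfl⟩ := hg
        rw [← map_mul, res_delta, res_delta, delta_mul]
      · rw [res_delta_of_notMem hθ hg, res_delta_of_notMem, mul_zero]
        rintro ⟨k, hk⟩
        exact hg ⟨h⁻¹ * k, by rw [map_mul, hk, map_inv, inv_mul_cancel_left]⟩

theorem res_star (x : GroupAlg G) : res θ hθ (star x) = star (res θ hθ x) := by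
  induction x using induction with
  | zero => simp
  | add x y hx hy => rw [star_add, map_add, hx, hy, map_add, star_add]
  | single g c =>
    rw [star_smul, star_delta, map_smul, map_smul, star_smul]
    congr 1
    by_cases hg : g ∈ Set.range θ
    · obtain ⟨k, rfl⟩ := hg
      rw [← map_inv, res_delta, res_delta, star_delta]
    · rw [res_delta_of_notMem hθ hg, res_delta_of_notMem, star_zero]
      rintro ⟨k, hk⟩
      exact hg ⟨k⁻¹, by rw [map_inv, hk, inv_inv]⟩

theorem res_mul_emb (x : GroupAlg G) (y : GroupAlg H) :
    res θ hθ (x * emb θ y) = res θ hθ x * y := by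
  have := congrArg star (res_emb_mul hθ (star y) (star x))
  rwa [← res_star, star_mul, star_star, emb_star, star_star, star_mul, star_star, res_star,
    star_star] at this

/-- Decomposition of `res (x⋆ y)` along the cosets of the range of `θ`. -/
theorem res_decomp (x : GroupAlg G) : ∃ s : Finset (G ⧸ θ.range), ∀ s', s ⊆ s' →
    ∀ y, res θ hθ (star x * y) = ∑ c ∈ s', star (res θ hθ (delta c.out⁻¹ * x)) *
      res θ hθ (delta c.out⁻¹ * y) := by
  classical
  induction x using induction with
  | zero => exact ⟨∅, fun s' _ y => by simp⟩
  | add x z hx hz =>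
    obtain ⟨s, hs⟩ := hx
    obtain ⟨t, ht⟩ := hz
    refine ⟨s ∪ t, fun s' h y => ?_⟩
    rw [star_add, add_mul, map_add, hs s' (Finset.union_subset_left h),
      ht s' (Finset.union_subset_right h), ← Finset.sum_add_distrib]
    refine Finset.sum_congr rfl fun c _ => ?_
    rw [mul_add, map_add, star_add, add_mul]
  | single a d =>
    refine ⟨{(a : G ⧸ θ.range)}, fun s' h y => ?_⟩
    rw [Finset.sum_eq_single_of_mem (a : G ⧸ θ.range) (h (Finset.mem_singleton_self _))]
    · obtain ⟨k, hk⟩ : ∃ k, θ k = (a : G ⧸ θ.range).out⁻¹ * a := by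
        have : (((a : G ⧸ θ.range).out : G) : G ⧸ θ.range) = (a : G ⧸ θ.range) :=
          Quotient.out_eq' _
        exact QuotientGroup.eq.1 this
      rw [mul_smul_comm, delta_mul, ← hk, map_smul, res_delta, star_smul, star_smul,
        smul_mul_assoc, smul_mul_assoc, map_smul, star_delta, star_delta, ← res_emb_mul,
        emb_delta, ← mul_assoc, delta_mul, map_inv, hk, mul_inv_rev, inv_inv]
      congr 4
      group
    · intro c _ hc
      rw [mul_smul_comm, delta_mul, map_smul, res_delta_of_notMem, smul_zero, star_zero, zero_mul]
      intro hk
      refine hc ?_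
      rw [← QuotientGroup.out_eq' c]
      exact QuotientGroup.eq.2 hk

theorem res_pos (x : GroupAlg G) :
    ∃ b : GroupCStar H, GroupCStar.incl (res θ hθ (star x * x)) = star b * b := by
  let _ := CStarAlgebra.spectralOrder (GroupCStar H)
  let _ := CStarAlgebra.spectralOrderedRing (GroupCStar H)
  rw [← CStarAlgebra.nonneg_iff_eq_star_mul_self]
  obtain ⟨s, hs⟩ := res_decomp hθ x
  rw [hs s subset_rfl, map_sum]
  refine Finset.sum_nonneg fun c _ => ?_
  rw [GroupCStar.incl_mul, ← GroupCStar.star_incl]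
  exact star_mul_self_nonneg _

/-- The `C⋆(H)`-valued semi-inner product on `ℂ[G]` that induces representations from `H`. -/
noncomputable def resInner : SemiInner (GroupCStar H) (GroupAlg G) where
  ip x y := GroupCStar.incl (res θ hθ (star x * y))
  add_right x y z := by rw [mul_add, map_add, map_add]
  smul_right c x y := by rw [mul_smul_comm, map_smul, map_smul]
  star_ip x y := by rw [GroupCStar.star_incl, ← res_star, star_mul, star_star]
  pos x := res_pos hθ x
  act x y := ⟨x * emb θ (res θ hθ (star x * y)), fun w => by
    rw [← mul_assoc, res_mul_emb, GroupCStar.incl_mul]⟩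

/-- `ℂ[G]` with the seminorm of `resInner`. -/
def IndSpace (_ : Function.Injective θ) : Type u := GroupAlg G

noncomputable instance : AddCommGroup (IndSpace hθ) := inferInstanceAs (AddCommGroup (GroupAlg G))

noncomputable instance : Module ℂ (IndSpace hθ) := inferInstanceAs (Module ℂ (GroupAlg G))

noncomputable instance : SeminormedAddCommGroup (IndSpace hθ) :=
  AddGroupSeminorm.toSeminormedAddCommGroup (E := IndSpace hθ)
    (resInner hθ).seminorm.toAddGroupSeminorm

noncomputable instance : NormedSpace ℂ (IndSpace hθ) where
  norm_smul_le c x := (map_smul_eq_mul (resInner hθ).seminorm c x).le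

/-- The identity map `ℂ[G] → IndSpace`. -/
noncomputable def toInd : GroupAlg G ≃ₗ[ℂ] IndSpace hθ := LinearEquiv.refl ℂ _

theorem norm_toInd_sq (x : GroupAlg G) :
    ‖toInd hθ x‖ ^ 2 = ‖res θ hθ (star x * x)‖ :=
  ((resInner hθ).seminorm_sq x).trans (GroupCStar.norm_incl _)

theorem norm_res_le_toInd (x y : GroupAlg G) :
    ‖res θ hθ (star x * y)‖ ≤ ‖toInd hθ x‖ * ‖toInd hθ y‖ :=
  (GroupCStar.norm_incl _).symm.le.trans ((resInner hθ).norm_ip_le x y)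

theorem exists_bound (f : GroupAlg G) :
    ∃ C : ℝ, ∀ x, ‖toInd hθ (f * x)‖ ≤ C * ‖toInd hθ x‖ := by
  induction f using induction with
  | zero => exact ⟨0, fun x => by simp⟩
  | add f g hf hg =>
    obtain ⟨C, hC⟩ := hf
    obtain ⟨D, hD⟩ := hg
    refine ⟨C + D, fun x => ?_⟩
    rw [add_mul, map_add, add_mul]
    exact (norm_add_le _ _).trans (add_le_add (hC x) (hD x))
  | single g c =>
    refine ⟨‖c‖, fun x => ?_⟩
    rw [smul_mul_assoc, map_smul, norm_smul]
    have : ‖toInd hθ (delta g * x)‖ = ‖toInd hθ x‖ := by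
      rw [← sq_eq_sq₀ (norm_nonneg _) (norm_nonneg _), norm_toInd_sq, norm_toInd_sq, star_mul,
        star_delta, mul_assoc, ← mul_assoc (delta g⁻¹), delta_mul, inv_mul_cancel, delta_one,
        one_mul]
    rw [this]

/-- Left multiplication on `IndSpace`. -/
noncomputable def indRep : GroupAlg G →ₗ[ℂ] (IndSpace hθ →L[ℂ] IndSpace hθ) where
  toFun f := LinearMap.mkContinuousOfExistsBound
    ((toInd hθ).toLinearMap ∘ₗ LinearMap.mulLeft ℂ f ∘ₗ (toInd hθ).symm.toLinearMap)
    (by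
      obtain ⟨C, hC⟩ := exists_bound hθ f
      exact ⟨C, fun x => hC x⟩)
  map_add' f g := by
    ext x
    exact congrArg (toInd hθ) (add_mul f g _)
  map_smul' c f := by
    ext x
    exact congrArg (toInd hθ) (smul_mul_assoc c f _)

theorem indRep_apply (f x : GroupAlg G) : indRep hθ f (toInd hθ x) = toInd hθ (f * x) := rfl

theorem isCStarSeminorm_indRep :
    IsCStarSeminorm ((normSeminorm ℂ (IndSpace hθ →L[ℂ] IndSpace hθ)).comp (indRep hθ)) := by
  have hmul : ∀ f g : GroupAlg G, ‖indRep hθ (f * g)‖ ≤ ‖indRep hθ f‖ * ‖indRep hθ g‖ := by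
    intro f g
    have : indRep hθ (f * g) = (indRep hθ f).comp (indRep hθ g) := by
      ext x
      exact congrArg (toInd hθ) (mul_assoc f g _)
    rw [this]
    exact ContinuousLinearMap.opNorm_comp_le _ _
  have hsq : ∀ f : GroupAlg G, ‖indRep hθ f‖ ^ 2 ≤ ‖indRep hθ (star f * f)‖ := by
    intro f
    have : ‖indRep hθ f‖ ≤ √‖indRep hθ (star f * f)‖ := by
      refine ContinuousLinearMap.opNorm_le_bound _ (Real.sqrt_nonneg _) fun x => ?_
      obtain ⟨x, rfl⟩ := (toInd hθ).surjective x
      apply abs_le_of_sq_le_sq' _ (by positivity) |>.2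
      rw [mul_pow, Real.sq_sqrt (norm_nonneg _), indRep_apply, norm_toInd_sq, star_mul, mul_assoc,
        ← mul_assoc (star f)]
      refine (norm_res_le_toInd hθ _ _).trans ?_
      rw [← indRep_apply]
      have := (indRep hθ (star f * f)).le_opNorm (toInd hθ x)
      nlinarith [norm_nonneg (toInd hθ x)]
    calc _ ≤ √‖indRep hθ (star f * f)‖ ^ 2 := by gcongr
      _ = _ := Real.sq_sqrt (norm_nonneg _)
  have hstar : ∀ f : GroupAlg G, ‖indRep hθ f‖ ≤ ‖indRep hθ (star f)‖ := by
    intro f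
    have h1 := (hsq f).trans (hmul (star f) f)
    by_contra h
    push Not at h
    nlinarith [norm_nonneg (indRep hθ (star f))]
  refine ⟨hmul, fun f => ?_⟩
  show ‖indRep hθ (star f * f)‖ = ‖indRep hθ f‖ ^ 2
  refine le_antisymm ((hmul _ _).trans ?_) (hsq f)
  have := hstar (star f)
  rw [star_star] at this
  rw [sq]
  gcongr

/-- `res` is contractive for the maximal C⋆-seminorms. -/
theorem norm_res_le (x : GroupAlg G) : ‖res θ hθ x‖ ≤ ‖x‖ := by
  have h1 : ‖indRep hθ x‖ ≤ ‖x‖ := le_maxNorm (isCStarSeminorm_indRep hθ) x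
  have h2 := norm_res_le_toInd hθ 1 x
  have h3 : ‖toInd hθ (1 : GroupAlg G)‖ ≤ 1 := by
    have := norm_toInd_sq hθ (1 : GroupAlg G)
    have e : res θ hθ (1 : GroupAlg G) = delta 1 := by
      have := res_delta hθ 1
      rwa [map_one] at this
    rw [star_one, mul_one, e] at this
    have h4 := norm_delta_le (1 : H)
    nlinarith [norm_nonneg (toInd hθ (1 : GroupAlg G))]
  have h4 := (indRep hθ x).le_opNorm (toInd hθ 1)
  rw [indRep_apply, mul_one] at h4
  rw [star_one, one_mul] at h2
  calc _ ≤ ‖toInd hθ (1 : GroupAlg G)‖ * ‖toInd hθ x‖ := h2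
    _ ≤ 1 * (‖indRep hθ x‖ * 1) := by
      gcongr
      exact h4.trans (by gcongr)
    _ ≤ ‖x‖ := by simpa using h1

end GroupAlg

namespace GroupCStar

variable {G H : Type u} [Group G] [Group H] (θ : H →* G)

/-- The unital ⋆-homomorphism `δ_h ↦ δ_{θ(h)}` from `C⋆(H)` to `C⋆(G)`. -/
noncomputable def map : GroupCStar H →⋆ₐ[ℂ] GroupCStar G :=
  let f : GroupCStar H →L[ℂ] GroupCStar G :=
    ((GroupAlg.emb θ).toLinearMap.mkContinuous 1
      fun x => by rw [one_mul]; exact GroupAlg.norm_emb_le θ x).completion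
  have hf : ∀ x, f (incl x) = incl (GroupAlg.emb θ x) := fun x =>
    ContinuousLinearMap.completion_apply_coe _ x
  have hone : f 1 = 1 := (hf 1).trans (by rw [map_one]; rfl)
  { toFun := f
    map_one' := hone
    map_mul' := fun x y => by
      induction x using ind with
      | hc => exact isClosed_eq (by fun_prop) (by fun_prop)
      | h x =>
      induction y using ind with
      | hc => exact isClosed_eq (by fun_prop) (by fun_prop)
      | h y => rw [← incl_mul, hf, hf, hf, map_mul, incl_mul]
    map_zero' := map_zero f
    map_add' := map_add f
    commutes' := fun c => by
      show f (algebraMap ℂ _ c) = algebraMap ℂ _ c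
      rw [Algebra.algebraMap_eq_smul_one, Algebra.algebraMap_eq_smul_one, map_smul, hone]
    map_star' := fun x => by
      show f (star x) = star (f x)
      induction x using ind with
      | hc => exact isClosed_eq (by fun_prop) (by fun_prop)
      | h x => rw [star_incl, hf, hf, star_incl, GroupAlg.emb_star] }

theorem map_incl (x : GroupAlg H) : map θ (incl x) = incl (GroupAlg.emb θ x) :=
  ContinuousLinearMap.completion_apply_coe _ x

theorem continuous_map : Continuous (map θ) := Completion.continuous_map

theorem map_δ (h : H) : map θ (δ h) = δ (θ h) := by
  rw [δ, map_incl, GroupAlg.emb_delta]; rfl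

variable {θ} (hθ : Function.Injective θ)

/-- The bounded linear map `C⋆(G) → C⋆(H)` with `δ_g ↦ δ_{θ⁻¹(g)}` for `g` in the range of `θ` and
`δ_g ↦ 0` otherwise. -/
noncomputable def restrict : GroupCStar G →L[ℂ] GroupCStar H :=
  ((GroupAlg.res θ hθ).mkContinuous 1
    fun x => by rw [one_mul]; exact GroupAlg.norm_res_le hθ x).completion

theorem restrict_incl (x : GroupAlg G) : restrict hθ (incl x) = incl (GroupAlg.res θ hθ x) :=
  ContinuousLinearMap.completion_apply_coe _ x

theorem restrict_δ (h : H) : restrict hθ (δ (θ h)) = δ h := by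
  rw [δ, restrict_incl, GroupAlg.res_delta]; rfl

theorem restrict_δ_of_notMem {g : G} (hg : g ∉ Set.range θ) : restrict hθ (δ g) = 0 := by
  rw [δ, restrict_incl, GroupAlg.res_delta_of_notMem hθ hg, map_zero]

theorem restrict_star (x : GroupCStar G) : restrict hθ (star x) = star (restrict hθ x) := by
  induction x using ind with
  | hc => exact isClosed_eq (by fun_prop) (by fun_prop)
  | h x => rw [star_incl, restrict_incl, restrict_incl, star_incl, GroupAlg.res_star]

theorem restrict_pos (x : GroupCStar G) : ∃ b, restrict hθ (star x * x) = star b * b := by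
  refine ind (motive := fun x => ∃ b, restrict hθ (star x * x) = star b * b)
    (ExelLarsenSystem.isClosed_pos.preimage (f := fun x => restrict hθ (star x * x))
      (by fun_prop)) (fun x => ?_) x
  rw [star_incl, ← incl_mul, restrict_incl]
  exact GroupAlg.res_pos hθ x

theorem restrict_map_mul (x : GroupCStar H) (y : GroupCStar G) :
    restrict hθ (map θ x * y) = x * restrict hθ y := by
  have hc := continuous_map θ
  induction x using ind with
  | hc => exact isClosed_eq (by fun_prop) (by fun_prop)
  | h x =>
  induction y using ind with
  | hc => exact isClosed_eq (by fun_prop) (by fun_prop)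
  | h y =>
    rw [map_incl, ← incl_mul, restrict_incl, restrict_incl, GroupAlg.res_emb_mul, incl_mul]

/-- Continuous linear maps on `C⋆(G)` are determined by their values on the `δ_g`. -/
theorem clm_ext {F : Type*} [NormedAddCommGroup F] [NormedSpace ℂ F] {S T : GroupCStar G →L[ℂ] F}
    (h : ∀ g, S (δ g) = T (δ g)) (x : GroupCStar G) : S x = T x := by
  induction x using ind with
  | hc => exact isClosed_eq (by fun_prop) (by fun_prop)
  | h x =>
    induction x using GroupAlg.induction with
    | zero => simp
    | add x y hx hy => rw [map_add, map_add, hx, hy, map_add]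
    | single g c => rw [map_smul, map_smul, map_smul]; exact congrArg _ (h g)

end GroupCStar

/-! ### Algebraic dynamical systems -/

/-- An algebraic dynamical system `(G, P, θ)`: a countable discrete group `G`, a countable right
LCM semigroup `P` with identity, and an action `θ` of `P` by injective endomorphisms of `G` that
respects the order on `P`. -/
structure AlgebraicDynamicalSystem (G : Type u) (P : Type v) [Group G] [Monoid P] where
  countable_group : Countable G
  countable_semigroup : Countable P
  rightLCM : IsRightLCM P
  θ : P → (G →* G)
  θ_one : ∀ g, θ 1 g = g
  θ_mul : ∀ p q g, θ (p * q) g = θ p (θ q g)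
  injective : ∀ p, Function.Injective (θ p)
  respects : ∀ p q r : P, rightIdeal p ∩ rightIdeal q = rightIdeal r →
    Set.range (θ p) ∩ Set.range (θ q) = Set.range (θ r)

namespace AlgebraicDynamicalSystem

open GroupCStar

variable {G : Type u} {P : Type v} [Group G] [Monoid P] (Φ : AlgebraicDynamicalSystem G P)

/-- The action `α_p(δ_g) = δ_{θ_p(g)}` of `P` on `C⋆(G)` together with the transfer operators
`L_p(δ_g) = δ_{θ_p⁻¹(g)}` if `g ∈ θ_p(G)`, and `L_p(δ_g) = 0` otherwise. -/
noncomputable def exelLarsenSystem : ExelLarsenSystem (GroupCStar G) P where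
  α p := GroupCStar.map (Φ.θ p)
  L p := restrict (Φ.injective p)
  α_one a := by
    refine clm_ext (S := ⟨(GroupCStar.map (Φ.θ 1)).toAlgHom.toLinearMap, continuous_map _⟩)
      (T := ContinuousLinearMap.id ℂ _) (fun g => ?_) a
    show GroupCStar.map (Φ.θ 1) (δ g) = δ g
    rw [map_δ, Φ.θ_one]
  α_mul p q a := by
    refine clm_ext (S := ⟨(GroupCStar.map (Φ.θ (p * q))).toAlgHom.toLinearMap, continuous_map _⟩)
      (T := (⟨(GroupCStar.map (Φ.θ p)).toAlgHom.toLinearMap, continuous_map _⟩ :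
        GroupCStar G →L[ℂ] GroupCStar G).comp
        ⟨(GroupCStar.map (Φ.θ q)).toAlgHom.toLinearMap, continuous_map _⟩) (fun g => ?_) a
    show GroupCStar.map (Φ.θ (p * q)) (δ g) = GroupCStar.map (Φ.θ p) (GroupCStar.map (Φ.θ q) (δ g))
    rw [map_δ, map_δ, map_δ, Φ.θ_mul]
  L_one a := by
    refine clm_ext (T := ContinuousLinearMap.id ℂ _) (fun g => ?_) a
    show restrict (Φ.injective 1) (δ g) = δ g
    conv_lhs => rw [← Φ.θ_one g]
    exact restrict_δ _ g
  L_mul p q a := by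
    refine clm_ext (T := (restrict (Φ.injective q)).comp (restrict (Φ.injective p)))
      (fun g => ?_) a
    show restrict _ (δ g) = restrict _ (restrict _ (δ g))
    by_cases hp : g ∈ Set.range (Φ.θ p)
    · obtain ⟨k, rfl⟩ := hp
      rw [restrict_δ]
      by_cases hq : k ∈ Set.range (Φ.θ q)
      · obtain ⟨l, rfl⟩ := hq
        rw [← Φ.θ_mul, restrict_δ, restrict_δ]
      · rw [restrict_δ_of_notMem _ hq, restrict_δ_of_notMem]
        rintro ⟨l, hl⟩
        rw [Φ.θ_mul] at hl
        exact hq ⟨l, Φ.injective p hl⟩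
    · rw [restrict_δ_of_notMem _ hp, map_zero, restrict_δ_of_notMem]
      rintro ⟨l, hl⟩
      rw [Φ.θ_mul] at hl
      exact hp ⟨_, hl⟩
  L_unital p := by
    have : (1 : GroupCStar G) = δ (Φ.θ p 1) := by rw [map_one]; rfl
    conv_lhs => rw [this, restrict_δ]
    rfl
  L_star p := restrict_star _
  L_pos p := restrict_pos _
  transfer p := restrict_map_mul _

/-- The product system `M` of `(G, P, θ)`. -/
noncomputable def productSystem : ProductSystem.{u, v, u} (GroupCStar G) P :=
  Φ.exelLarsenSystem.productSystem

/-- The map `π_p : C⋆(G) → M_p`. -/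
noncomputable def pi (p : P) : GroupCStar G →ₗ[ℂ] Φ.productSystem.Fibre p :=
  Φ.exelLarsenSystem.pi p

/-- The characterising formula `π_p(δ_g) π_q(δ_h) = π_{pq}(δ_{g θ_p(h)})` for the product. -/
theorem mul_pi_δ {p q r : P} (hr : p * q = r) (g h : G) :
    Φ.productSystem.mul hr (Φ.pi p (δ g)) (Φ.pi q (δ h)) = Φ.pi r (δ (g * Φ.θ p h)) := by
  refine (Φ.exelLarsenSystem.mulC_pi hr (δ g) (δ h)).trans ?_
  show Φ.pi r (δ g * GroupCStar.map (Φ.θ p) (δ h)) = _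
  rw [map_δ, δ, δ, ← incl_mul, GroupAlg.delta_mul]; rfl

end AlgebraicDynamicalSystem

end CStarProductSystem

open CStarProductSystem

universe uA uS uM uG uP

namespace CStarProductSystem

universe u v w

open RightHilbertBimodule Filter Topology

/-! ### Adjointable and compact operators on one Hilbert bimodule. -/

section Bimodule

variable {A : Type u} {E : Type v} [CStarAlgebra A] [NormedAddCommGroup E]
    [NormedSpace ℂ E] [RightHilbertBimodule A E]

/-! (CA) implies compact alignment because Parseval frames act as approximate units for the
compacts. Since `y = ∑ ξ_i · ⟨ξ_i, y⟩` and `Θ_{x,y}` depends continuously on `x` and on `y`, one has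
`Θ_{x,y} = ∑ Θ_{x,y} Θ_{ξ_i,ξ_i}` and `Θ_{x',y'} = ∑ Θ_{η_j,η_j} Θ_{x',y'}` in operator norm. On
adjointable operators `ι_p^r` is linear, multiplicative, adjoint-preserving and contractive
(`IsAmplification.isAdjoint`, `IsAmplification.norm_le`). So `ι_p^r(T) ι_q^r(T')` is approximated by
combinations of `ι(Θ_{x,y}) [ι(Θ_{ξ_i,ξ_i}) ι(Θ_{η_j,η_j})] ι(Θ_{x',y'})`. The bracket is compact by
(CA), the outer factors are adjointable, and the compacts are a closed two-sided ideal in the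
adjointable operators (`iota_mem_compacts_of_hasSum`, `ConditionCA.isCompactlyAligned`).

For an algebraic dynamical system, `Θ_{ξ,ξ}` with `ξ = π_p(δ_g)` is the projection that keeps the
`π_p(δ_h)` with `h ∈ g θ_p(G)` and kills the others. A transversal of `G / θ_p(G)` therefore gives a
Parseval frame. Under `ι_p^r` such a projection still selects the coset `g θ_p(G)`, now inside
`M_r`. A product of two of them selects `g θ_p(G) ∩ k θ_q(G)`, which is empty or a single coset of
`θ_p(G) ∩ θ_q(G) = θ_r(G)`: the product is zero or a rank-one operator, and (CA) holds without any
assumption on the left action.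

The left action is unital, so it is by compacts exactly when the identity of `M_p` is compact. For
finite index the identity is a finite sum of rank-one projections. For infinite index the coset
projections tend strongly to zero, so their products with a compact operator tend to zero in norm;
but each has norm at least one. Multiplication by powers of `X` on `ℤ[X]` has infinite index for
every nonzero power, which gives the example. -/

theorem ip_add_left (x y z : E) : (ip (x + y) z : A) = ip x z + ip y z :=
  (bimoduleSemiInner A E).add_left x y z

theorem ip_smul_left (c : ℂ) (x y : E) : (ip (c • x) y : A) = (starRingEnd ℂ) c • ip x y :=
  (bimoduleSemiInner A E).smul_left c x y

theorem ip_sub_right (x y z : E) : (ip x (y - z) : A) = ip x y - ip x z :=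
  (ipRight A x).map_sub y z

theorem ip_ract_left (x y : E) (a : A) : (ip (ract x a) y : A) = star a * ip x y := by
  rw [← star_ip, ip_ract_right, star_mul, star_ip]

theorem eq_of_ip_eq {x y : E} (h : ∀ z, (ip z x : A) = ip z y) : x = y := by
  rw [← sub_eq_zero, ← norm_eq_zero, ← sq_eq_zero_iff, norm_sq (A := A), ip_sub_right, h,
    sub_self, norm_zero]

theorem continuous_ip_left (y : E) : Continuous fun x : E => (ip x y : A) := by
  simp_rw [← fun x : E => star_ip (A := A) y x]
  exact continuous_star.comp (ipRight A y).continuous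

theorem norm_ipRight_le (x : E) : ‖ipRight A x‖ ≤ ‖x‖ :=
  LinearMap.mkContinuous_norm_le _ (norm_nonneg x) _

/-- The additive map `x ↦ ⟨x, ·⟩`. -/
noncomputable def ipRightHom (A : Type u) (E : Type v) [CStarAlgebra A] [NormedAddCommGroup E]
    [NormedSpace ℂ E] [RightHilbertBimodule A E] : E →+ (E →L[ℂ] A) where
  toFun x := ipRight A x
  map_zero' := by
    ext y
    exact ProductSystem.ip_zero_left y
  map_add' x y := by
    ext z
    exact ip_add_left x y z

theorem continuous_ipRight : Continuous (ipRight A : E → E →L[ℂ] A) :=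
  AddMonoidHomClass.continuous_of_bound (ipRightHom A E) 1 fun x => by
    rw [one_mul]
    exact norm_ipRight_le x

theorem rankOne_apply (x y z : E) : rankOne A x y z = ract x (ip y z : A) := rfl

/-- `y ↦ Θ_{x,y}` as an additive map. -/
noncomputable def rankOneHom (A : Type u) {E : Type v} [CStarAlgebra A] [NormedAddCommGroup E]
    [NormedSpace ℂ E] [RightHilbertBimodule A E] (x : E) : E →+ (E →L[ℂ] E) where
  toFun y := rankOne A x y
  map_zero' := by
    ext z
    rw [rankOne_apply, ProductSystem.ip_zero_left, map_zero]; rfl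
  map_add' y y' := by
    ext z
    rw [rankOne_apply, ip_add_left, map_add]; rfl

theorem continuous_rankOne_right (x : E) : Continuous (rankOne A x) :=
  continuous_const.clm_comp continuous_ipRight

/-- `x ↦ Θ_{x,y}` as a bounded linear map. -/
noncomputable def rankOneL (A : Type u) {E : Type v} [CStarAlgebra A] [NormedAddCommGroup E]
    [NormedSpace ℂ E] [RightHilbertBimodule A E] (y : E) : E →L[ℂ] (E →L[ℂ] E) :=
  ((ContinuousLinearMap.compL ℂ E A E).flip (ipRight A y)).comp ract

/-- `T'` is the adjoint of `T`. -/
def IsAdjoint (A : Type u) {E : Type v} [CStarAlgebra A] [NormedAddCommGroup E]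
    [NormedSpace ℂ E] [RightHilbertBimodule A E] (T T' : E →L[ℂ] E) : Prop :=
  ∀ x y : E, (ip (T x) y : A) = ip x (T' y)

namespace IsAdjoint

variable {T T' R R' : E →L[ℂ] E}

theorem isAdjointable (h : IsAdjoint A T T') : IsAdjointable A T := ⟨T', h⟩

theorem symm (h : IsAdjoint A T T') : IsAdjoint A T' T := fun x y => by
  rw [← star_ip, ← h, star_ip]

theorem add (h : IsAdjoint A T T') (k : IsAdjoint A R R') : IsAdjoint A (T + R) (T' + R') :=
  fun x y => by
    rw [add_apply, add_apply, ip_add_left, ip_add_right,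
      h, k]

theorem smul (c : ℂ) (h : IsAdjoint A T T') : IsAdjoint A (c • T) ((starRingEnd ℂ) c • T') :=
  fun x y => by
    rw [smul_apply, smul_apply, ip_smul_left,
      ip_smul_right, h]

theorem zero : IsAdjoint A (0 : E →L[ℂ] E) 0 := fun x y =>
  (ProductSystem.ip_zero_left y).trans (ProductSystem.ip_zero_right x).symm

theorem sub (h : IsAdjoint A T T') (k : IsAdjoint A R R') : IsAdjoint A (T - R) (T' - R') := by
  have := h.add (k.smul (-1))
  simpa [sub_eq_add_neg] using this

theorem comp (h : IsAdjoint A T T') (k : IsAdjoint A R R') : IsAdjoint A (T.comp R) (R'.comp T') :=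
  fun x y => by
    rw [ContinuousLinearMap.comp_apply, ContinuousLinearMap.comp_apply, h, k]

/-- An operator here is only assumed complex linear; right `A`-linearity is forced by the existence
of an adjoint. It is what gives `T Θ_{x,y} = Θ_{Tx,y}`. -/
theorem map_ract (h : IsAdjoint A T T') (x : E) (a : A) : T (ract x a) = ract (T x) a :=
  eq_of_ip_eq fun z => by
    rw [ip_ract_right, ← h.symm, ip_ract_right, h.symm]

theorem rankOne (x y : E) : IsAdjoint A (rankOne A x y) (CStarProductSystem.rankOne A y x) :=
  fun z w => by
    rw [rankOne_apply, rankOne_apply, ip_ract_left, ip_ract_right, star_ip]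

theorem comp_rankOne (h : IsAdjoint A T T') (x y : E) :
    T.comp (CStarProductSystem.rankOne A x y) = CStarProductSystem.rankOne A (T x) y := by
  ext z
  exact h.map_ract _ _

theorem rankOne_comp (h : IsAdjoint A T T') (x y : E) :
    (CStarProductSystem.rankOne A x y).comp T = CStarProductSystem.rankOne A x (T' y) := by
  ext z
  rw [ContinuousLinearMap.comp_apply, rankOne_apply, rankOne_apply, h.symm]

/-- Cauchy-Schwarz applied to `⟨T' y, T' y⟩ = ⟨T T' y, y⟩`, followed by cancelling one factor `‖T'
y‖`. -/
theorem norm_le (h : IsAdjoint A T T') : ‖T'‖ ≤ ‖T‖ := by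
  refine ContinuousLinearMap.opNorm_le_bound _ (norm_nonneg _) fun y => ?_
  have h1 : ‖T' y‖ ^ 2 ≤ ‖T‖ * ‖T' y‖ * ‖y‖ := by
    rw [norm_sq (A := A), ← h]
    refine (norm_ip_le A _ _).trans ?_
    gcongr
    exact T.le_opNorm _
  rcases (norm_nonneg (T' y)).eq_or_lt with h0 | h0
  · rw [← h0]; positivity
  · refine le_of_mul_le_mul_left ?_ h0
    linarith

end IsAdjoint

/-- Taking adjoints does not increase norms, so the adjoints of a convergent sequence are Cauchy and
their limit is the adjoint of the limit. Closedness matters because `iota` is controlled only on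
adjointable operators, and limits must stay there. -/
theorem isClosed_isAdjointable : IsClosed {T : E →L[ℂ] E | IsAdjointable A T} := by
  have := complete (A := A) (E := E)
  refine IsSeqClosed.isClosed fun f T hf hT => ?_
  choose g hg using hf
  have hc : CauchySeq g := by
    have h1 := hT.cauchySeq
    rw [Metric.cauchySeq_iff] at h1 ⊢
    intro ε hε
    obtain ⟨N, hN⟩ := h1 ε hε
    refine ⟨N, fun m hm n hn => lt_of_le_of_lt ?_ (hN m hm n hn)⟩
    rw [dist_eq_norm, dist_eq_norm]
    exact IsAdjoint.norm_le (A := A) (IsAdjoint.sub (hg m) (hg n))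
  obtain ⟨T', hT'⟩ := cauchySeq_tendsto_of_complete hc
  refine ⟨T', fun x y => ?_⟩
  have h1 : Tendsto (fun n => (ip (f n x) y : A)) atTop (𝓝 (ip (T x) y)) :=
    ((continuous_ip_left y).tendsto _).comp
      (((ContinuousLinearMap.apply ℂ E x).continuous.tendsto T).comp hT)
  have h2 : Tendsto (fun n => (ip x (g n y) : A)) atTop (𝓝 (ip x (T' y))) :=
    ((ipRight A x).continuous.tendsto _).comp
      (((ContinuousLinearMap.apply ℂ E y).continuous.tendsto T').comp hT')
  exact tendsto_nhds_unique h1 (h2.congr fun n => (hg n x y).symm)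

theorem rankOne_mem_compacts (x y : E) : rankOne A x y ∈ compacts A E :=
  Submodule.le_topologicalClosure _ (Submodule.subset_span ⟨x, y, rfl⟩)

theorem compacts_le {K : Submodule ℂ (E →L[ℂ] E)} (hK : IsClosed (K : Set (E →L[ℂ] E)))
    (h : ∀ x y : E, rankOne A x y ∈ K) : compacts A E ≤ K := by
  refine Submodule.topologicalClosure_minimal _ (Submodule.span_le.2 ?_) hK
  rintro _ ⟨x, y, rfl⟩
  exact h x y

theorem isClosed_compacts : IsClosed (compacts A E : Set (E →L[ℂ] E)) :=
  Submodule.isClosed_topologicalClosure _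

/-- The compacts are a left ideal in the adjointable operators. -/
theorem comp_mem_compacts {R K : E →L[ℂ] E} (hR : IsAdjointable A R) (hK : K ∈ compacts A E) :
    R.comp K ∈ compacts A E := by
  obtain ⟨R', hR⟩ := hR
  refine compacts_le (K := (compacts A E).comap (ContinuousLinearMap.compL ℂ E E E R).toLinearMap)
    (isClosed_compacts.preimage (ContinuousLinearMap.compL ℂ E E E R).continuous)
    (fun x y => ?_) hK
  show R.comp (rankOne A x y) ∈ compacts A E
  rw [IsAdjoint.comp_rankOne hR]
  exact rankOne_mem_compacts _ _

/-- The compacts are a right ideal in the adjointable operators. -/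
theorem compacts_comp_mem {R K : E →L[ℂ] E} (hR : IsAdjointable A R) (hK : K ∈ compacts A E) :
    K.comp R ∈ compacts A E := by
  obtain ⟨R', hR⟩ := hR
  refine compacts_le
    (K := (compacts A E).comap ((ContinuousLinearMap.compL ℂ E E E).flip R).toLinearMap)
    (isClosed_compacts.preimage ((ContinuousLinearMap.compL ℂ E E E).flip R).continuous)
    (fun x y => ?_) hK
  show (rankOne A x y).comp R ∈ compacts A E
  rw [IsAdjoint.rankOne_comp hR]
  exact rankOne_mem_compacts _ _

/-- `Θ_{x,y} = ∑ Θ_{ξ_i,ξ_i} Θ_{x,y}` in norm for a Parseval frame `ξ`. -/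
theorem IsParsevalFrame.hasSum_comp_rankOne {I : Type w} {ξ : I → E} (h : IsParsevalFrame A ξ)
    (x y : E) :
    HasSum (fun i => (rankOne A (ξ i) (ξ i)).comp (rankOne A x y)) (rankOne A x y) := by
  have := (h.2 x).mapL (rankOneL A y)
  simp_rw [(IsAdjoint.rankOne _ _).comp_rankOne]
  exact this

/-- `Θ_{x,y} = ∑ Θ_{x,y} Θ_{ξ_i,ξ_i}` in norm for a Parseval frame `ξ`. -/
theorem IsParsevalFrame.hasSum_rankOne_comp {I : Type w} {ξ : I → E} (h : IsParsevalFrame A ξ)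
    (x y : E) :
    HasSum (fun i => (rankOne A x y).comp (rankOne A (ξ i) (ξ i))) (rankOne A x y) := by
  -- `Θ_{x,y}` is conjugate linear in `y`, so the expansion of `y` is transported by a continuous
  -- additive map instead of a bounded linear one.
  have := (h.2 y).map (rankOneHom A x) (continuous_rankOne_right x)
  simp_rw [(IsAdjoint.rankOne _ _).rankOne_comp]
  exact this

end Bimodule

/-! ### The homomorphisms `ι_p^r` on adjointable operators, and (CA) implies compact alignment. -/

namespace ProductSystem

variable {A : Type u} {S : Type v} [CStarAlgebra A] [Monoid S]
  (M : ProductSystem.{u, v, w} A S) {p q r : S}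

/-- `iota` is defined by a choice; uniqueness of amplifications removes it, so algebraic identities
for `iota` reduce to closure properties of `IsAmplification`. -/
theorem iota_eq {T : M.Fibre p →L[ℂ] M.Fibre p} {R : M.Fibre r →L[ℂ] M.Fibre r}
    (h : M.IsAmplification T R) : M.iota p r T = R := by
  have hex : ∃ R, M.IsAmplification T R := ⟨R, h⟩
  rw [iota, dif_pos hex]
  exact hex.choose_spec.unique h

namespace IsAmplification

variable {M} {T T' : M.Fibre p →L[ℂ] M.Fibre p} {R R' : M.Fibre r →L[ℂ] M.Fibre r}

theorem add (h : M.IsAmplification T R) (h' : M.IsAmplification T' R') :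
    M.IsAmplification (T + T') (R + R') := by
  refine ⟨h.1, fun q hq => ⟨fun x y => ?_, fun z hz => ?_⟩⟩
  · simp [(h.2 q hq).1, (h'.2 q hq).1]
  · simp [(h.2 q hq).2 z hz, (h'.2 q hq).2 z hz]

theorem smul (c : ℂ) (h : M.IsAmplification T R) : M.IsAmplification (c • T) (c • R) := by
  refine ⟨h.1, fun q hq => ⟨fun x y => ?_, fun z hz => ?_⟩⟩
  · simp [(h.2 q hq).1]
  · simp [(h.2 q hq).2 z hz]

theorem comp (h : M.IsAmplification T R) (h' : M.IsAmplification T' R') :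
    M.IsAmplification (T.comp T') (R.comp R') := by
  refine ⟨h.1, fun q hq => ⟨fun x y => ?_, fun z hz => ?_⟩⟩
  · simp [(h.2 q hq).1, (h'.2 q hq).1]
  · simp [(h'.2 q hq).2 z hz]

end IsAmplification

/-- Every element of `M_r` is the sum of a limit of sums of products and of an element orthogonal
to all products. -/
theorem exists_decomposition (h : p * q = r) (z : M.Fibre r) :
    ∃ z₁ z₂, z = z₁ + z₂ ∧ z₁ ∈ closure (Set.range (M.preAmp h 1)) ∧
      ∀ x y, (ip (M.mul h x y) z₂ : A) = 0 := by
  -- Products are dense in `M_r` only for `p ≠ 1`. For `p = 1` they span the range of the left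
  -- action, which may be degenerate; the self-adjoint idempotent `lact 1` then splits `z`.
  by_cases hp : p = 1
  · subst hp
    obtain rfl : q = r := by rw [← h, one_mul]
    refine ⟨lact (1 : A) z, z - lact (1 : A) z, by rw [add_sub_cancel], subset_closure ?_, ?_⟩
    · exact ⟨M.unit 1 ⊗ₜ z, by rw [preAmp_tmul, ← M.unit_mul]; rfl⟩
    · intro x y
      obtain ⟨a, rfl⟩ := M.unit.surjective x
      have h3 := ip_lact_left (1 : A) (lact a y) z
      rw [star_one, ← lact_mul, one_mul] at h3
      rw [M.unit_mul, ip_sub_right]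
      exact sub_eq_zero.2 h3
  · refine ⟨z, 0, (add_zero z).symm, ?_, fun x y => ip_zero_right _⟩
    have h1 := Submodule.dense_iff_topologicalClosure_eq_top.2 (M.dense_mul h hp)
    rw [← LinearMap.coe_range]
    refine closure_mono (SetLike.coe_subset_coe.2 (Submodule.span_le.2 ?_)) (h1 z)
    rintro _ ⟨x, y, rfl⟩
    exact ⟨x ⊗ₜ y, M.preAmp_tmul h 1 x y⟩

theorem ip_eq_zero_of_mem_closure (h : p * q = r) {z w : M.Fibre r}
    (hz : z ∈ closure (Set.range (M.preAmp h 1)))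
    (hw : ∀ x y, (ip (M.mul h x y) w : A) = 0) : (ip z w : A) = 0 := by
  refine closure_minimal (t := {z | (ip z w : A) = 0}) ?_
    (isClosed_eq (continuous_ip_left w) continuous_const) hz
  rintro _ ⟨t, rfl⟩
  show (ip _ w : A) = 0
  induction t with
  | zero => rw [map_zero, ip_zero_left]
  | add a b ha hb => rw [map_add, ip_add_left, ha, hb, add_zero]
  | tmul x y => rw [preAmp_tmul]; exact hw _ _

namespace IsAmplification

variable {M} {T T' : M.Fibre p →L[ℂ] M.Fibre p} {R R' : M.Fibre r →L[ℂ] M.Fibre r}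

/-- `preAmp h 1` is the multiplication map on the algebraic tensor product, so on its range `R` is
literally `T ⊗ id`. -/
theorem apply_preAmp (h : p * q = r) (hR : M.IsAmplification T R) (t) :
    R (M.preAmp h 1 t) = M.preAmp h T t := by
  induction t with
  | zero => simp
  | add a b ha hb => rw [map_add, map_add, ha, hb, map_add]
  | tmul x y => rw [preAmp_tmul, preAmp_tmul, (hR.2 q h).1]; rfl

theorem apply_mem_closure (h : p * q = r) (hR : M.IsAmplification T R) {z : M.Fibre r}
    (hz : z ∈ closure (Set.range (M.preAmp h 1))) :
    R z ∈ closure (Set.range (M.preAmp h 1)) := by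
  refine map_mem_closure R.continuous hz ?_
  rintro _ ⟨t, rfl⟩
  rw [hR.apply_preAmp]
  induction t with
  | zero => exact ⟨0, by simp⟩
  | add a b ha hb =>
    obtain ⟨a', ha⟩ := ha
    obtain ⟨b', hb⟩ := hb
    exact ⟨a' + b', by rw [map_add, ha, hb, map_add]⟩
  | tmul x y => exact ⟨T x ⊗ₜ y, by rw [preAmp_tmul, preAmp_tmul]; rfl⟩

/-- Both amplifications kill the complement of the products and preserve the closure of their span,
so all cross terms vanish. What remains is an identity on algebraic tensors, which `ip_preAmp`
supplies, extended by continuity in each variable. -/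
theorem isAdjoint (hT : IsAdjoint A T T') (hR : M.IsAmplification T R)
    (hR' : M.IsAmplification T' R') : IsAdjoint A R R' := by
  obtain ⟨q, h⟩ := hR.1
  intro z w
  obtain ⟨z₁, z₂, rfl, hz₁, hz₂⟩ := M.exists_decomposition h z
  obtain ⟨w₁, w₂, rfl, hw₁, hw₂⟩ := M.exists_decomposition h w
  have e : (ip z₂ (R' w₁) : A) = 0 := by
    rw [← star_ip, M.ip_eq_zero_of_mem_closure h (hR'.apply_mem_closure h hw₁) hz₂, star_zero]
  rw [map_add, (hR.2 q h).2 z₂ hz₂, map_add, (hR'.2 q h).2 w₂ hw₂, add_zero, add_zero,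
    ip_add_right, ip_add_left, e, M.ip_eq_zero_of_mem_closure h (hR.apply_mem_closure h hz₁) hw₂,
    add_zero, add_zero]
  refine closure_minimal (t := {z | (ip (R z) w₁ : A) = ip z (R' w₁)}) ?_
    (isClosed_eq ((continuous_ip_left w₁).comp R.continuous) (continuous_ip_left _)) hz₁
  rintro _ ⟨s, rfl⟩
  refine closure_minimal (t := {w | (ip (R (M.preAmp h 1 s)) w : A) = ip (M.preAmp h 1 s) (R' w)})
    ?_ (isClosed_eq (ipRight A _).continuous ((ipRight A _).continuous.comp R'.continuous)) hw₁
  rintro _ ⟨t, rfl⟩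
  show (ip _ _ : A) = ip _ _
  rw [hR.apply_preAmp, hR'.apply_preAmp]
  exact M.ip_preAmp h T 1 1 T' hT s t

/-- On tensors, `⟨(T ⊗ id) t, (T ⊗ id) t⟩ = ⟨t, (T⋆T ⊗ id) t⟩`, and the estimate
`norm_preAmp_selfAdjoint` for the self-adjoint operator `T⋆T` gives the factor `‖T⋆T‖ ≤ ‖T‖ ^ 2`.
The sharp constant yields continuity of `iota`. -/
theorem norm_le (hT : IsAdjointable A T) (hR : M.IsAmplification T R) : ‖R‖ ≤ ‖T‖ := by
  obtain ⟨q, h⟩ := hR.1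
  obtain ⟨T', hT⟩ := hT
  replace hT : IsAdjoint A T T' := hT
  refine ContinuousLinearMap.opNorm_le_bound _ (norm_nonneg _) fun z => ?_
  obtain ⟨z₁, z₂, rfl, hz₁, hz₂⟩ := M.exists_decomposition h z
  rw [map_add, (hR.2 q h).2 z₂ hz₂, add_zero]
  have h1 : ‖R z₁‖ ≤ ‖T‖ * ‖z₁‖ := by
    refine closure_minimal (t := {z | ‖R z‖ ≤ ‖T‖ * ‖z‖}) ?_
      (isClosed_le (by fun_prop) (by fun_prop)) hz₁
    rintro _ ⟨t, rfl⟩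
    show ‖R _‖ ≤ _
    rw [hR.apply_preAmp]
    have h2 := M.norm_preAmp_selfAdjoint h (T'.comp T) (hT.symm.comp hT) t
    have h3 : ‖M.preAmp h T t‖ ^ 2 ≤ ‖M.preAmp h 1 t‖ * ‖M.preAmp h (T'.comp T) t‖ := by
      rw [norm_sq (A := A), M.ip_preAmp h T 1 T (T'.comp T)]
      · exact norm_ip_le A _ _
      · intro x y
        rw [hT]; rfl
    have h4 : ‖T'.comp T‖ ≤ ‖T‖ * ‖T‖ :=
      (ContinuousLinearMap.opNorm_comp_le _ _).trans (by gcongr; exact hT.norm_le)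
    apply abs_le_of_sq_le_sq' _ (by positivity) |>.2
    calc _ ≤ ‖M.preAmp h 1 t‖ * (‖T‖ * ‖T‖ * ‖M.preAmp h 1 t‖) := by
          refine h3.trans ?_
          gcongr
          exact h2.trans (by gcongr)
      _ = _ := by ring
  -- By orthogonality `⟨z₁, z₁⟩ = ⟨z₁, z₁ + z₂⟩`, so Cauchy-Schwarz replaces Pythagoras.
  have h5 : ‖z₁‖ ≤ ‖z₁ + z₂‖ := by
    have h6 : ‖z₁‖ ^ 2 ≤ ‖z₁‖ * ‖z₁ + z₂‖ := by
      have : (ip z₁ z₁ : A) = ip z₁ (z₁ + z₂) := by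
        rw [ip_add_right, M.ip_eq_zero_of_mem_closure h hz₁ hz₂, add_zero]
      rw [norm_sq (A := A), this]
      exact norm_ip_le A _ _
    rcases (norm_nonneg z₁).eq_or_lt with h0 | h0
    · rw [← h0]; positivity
    · exact le_of_mul_le_mul_left (by linarith) h0
  exact h1.trans (by gcongr)

end IsAmplification

section Iota

variable (hS : ∀ p x y : S, p * x = p * y → x = y) (h : p * q = r)

include hS h

theorem isAdjointable_iota {T : M.Fibre p →L[ℂ] M.Fibre p} (hT : IsAdjointable A T) :
    IsAdjointable A (M.iota p r T) := by
  obtain ⟨T', hT'⟩ := hT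
  exact (IsAmplification.isAdjoint hT' (M.isAmplification_iota h hS T ⟨T', hT'⟩)
    (M.isAmplification_iota h hS T' ⟨T, IsAdjoint.symm hT'⟩)).isAdjointable

/-- `ι(T) - ι(R)` amplifies `T - R`, so contractivity makes `iota` 1-Lipschitz. The restriction to
adjointable operators is needed since elsewhere `iota` may take its default value `0`. -/
theorem continuousOn_iota : ContinuousOn (M.iota p r) {T | IsAdjointable A T} := by
  refine LipschitzOnWith.continuousOn (K := 1) (LipschitzOnWith.of_dist_le_mul ?_)
  rintro T ⟨T', hT'⟩ R ⟨R', hR'⟩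
  replace hT' : IsAdjoint A T T' := hT'
  rw [NNReal.coe_one, one_mul, dist_eq_norm, dist_eq_norm]
  have h1 := (M.isAmplification_iota h hS T hT'.isAdjointable).add
    ((M.isAmplification_iota h hS R ⟨R', hR'⟩).smul (-1))
  have h2 := h1.norm_le (hT'.add (IsAdjoint.smul (-1) hR')).isAdjointable
  simpa [sub_eq_add_neg] using h2

theorem iota_comp {T T' : M.Fibre p →L[ℂ] M.Fibre p} (hT : IsAdjointable A T)
    (hT' : IsAdjointable A T') :
    M.iota p r (T.comp T') = (M.iota p r T).comp (M.iota p r T') :=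
  M.iota_eq ((M.isAmplification_iota h hS T hT).comp (M.isAmplification_iota h hS T' hT'))

/-- If `f` is a bounded linear map on the operators on `M_r`, then `f (ι(T))` is compact for
every compact `T`, provided that this holds for a family of adjointable `T`s that sum up to any
rank-one operator. -/
theorem iota_mem_compacts_of_hasSum
    (f : (M.Fibre r →L[ℂ] M.Fibre r) →L[ℂ] (M.Fibre r →L[ℂ] M.Fibre r)) {I : Type*}
    (Θ : M.Fibre p → M.Fibre p → I → (M.Fibre p →L[ℂ] M.Fibre p))
    (hΘ : ∀ x y, HasSum (Θ x y) (rankOne A x y)) (hadj : ∀ x y i, IsAdjointable A (Θ x y i))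
    (hf : ∀ x y i, f (M.iota p r (Θ x y i)) ∈ compacts A (M.Fibre r))
    {T : M.Fibre p →L[ℂ] M.Fibre p} (hT : T ∈ compacts A (M.Fibre p)) :
    f (M.iota p r T) ∈ compacts A (M.Fibre r) := by
  -- Adjointability is built into `K` because `iota` is known to be additive and continuous only on
  -- adjointable operators. With it `K` is a closed subspace, and it suffices that `K` contains the
  -- rank-one operators.
  let K : Submodule ℂ (M.Fibre p →L[ℂ] M.Fibre p) :=
    { carrier := {T | IsAdjointable A T} ∩ M.iota p r ⁻¹' {R | f R ∈ compacts A (M.Fibre r)}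
      zero_mem' := by
        refine ⟨IsAdjoint.zero.isAdjointable, ?_⟩
        have : M.iota p r 0 = 0 := by
          have := (M.isAmplification_iota h hS 0 IsAdjoint.zero.isAdjointable).smul 0
          rw [smul_zero, zero_smul] at this
          exact M.iota_eq this
        show f (M.iota p r 0) ∈ compacts A (M.Fibre r)
        rw [this, map_zero]
        exact zero_mem _
      add_mem' := by
        rintro T R ⟨⟨T', hT⟩, hfT⟩ ⟨⟨R', hR⟩, hfR⟩
        refine ⟨(IsAdjoint.add hT hR).isAdjointable, ?_⟩
        show f (M.iota p r _) ∈ compacts A (M.Fibre r)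
        rw [M.iota_eq ((M.isAmplification_iota h hS T ⟨T', hT⟩).add
          (M.isAmplification_iota h hS R ⟨R', hR⟩)), map_add]
        exact add_mem hfT hfR
      smul_mem' := by
        rintro c T ⟨⟨T', hT⟩, hfT⟩
        refine ⟨(IsAdjoint.smul c hT).isAdjointable, ?_⟩
        show f (M.iota p r _) ∈ compacts A (M.Fibre r)
        rw [M.iota_eq ((M.isAmplification_iota h hS T ⟨T', hT⟩).smul c), map_smul]
        exact Submodule.smul_mem _ c hfT }
  have hK : IsClosed (K : Set (M.Fibre p →L[ℂ] M.Fibre p)) :=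
    (M.continuousOn_iota hS h).preimage_isClosed_of_isClosed isClosed_isAdjointable
      (isClosed_compacts.preimage f.continuous)
  refine (compacts_le hK (fun x y => ?_) hT).2
  exact hK.mem_of_tendsto (hΘ x y) (Eventually.of_forall fun F =>
    K.sum_mem fun i _ => ⟨hadj x y i, hf x y i⟩)

end Iota

/-- The expansion of `T` is taken on its right and that of `T'` on its left, so that the frame
operators meet in the middle of `ι(T) ι(T')`. The outer factors are then absorbed by the ideal
property, one side at a time with the other operator held fixed. -/
theorem ConditionCA.isCompactlyAligned {M : ProductSystem.{u, v, w} A S} (hS : IsRightLCM S)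
    (hM : M.ConditionCA) : M.IsCompactlyAligned := by
  intro p q r hr T hT T' hT'
  -- The generator `r = r * 1` lies in its own ideal, which gives the factorisations `r = p p' = q
  -- q'` behind the two amplifications.
  obtain ⟨⟨p', hp⟩, ⟨q', hq⟩⟩ : r ∈ rightIdeal p ∩ rightIdeal q :=
    hr ▸ ⟨1, (mul_one r).symm⟩
  obtain ⟨I, J, ξ, η, hξ, hη, hc⟩ := hM p q r hr
  have adj₁ : ∀ (s : S) (x y : M.Fibre s), IsAdjointable A (rankOne A x y) := fun s x y =>
    (IsAdjoint.rankOne x y).isAdjointable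
  have adj₂ : ∀ (s : S) (x y x' y' : M.Fibre s),
      IsAdjointable A ((rankOne A x y).comp (rankOne A x' y')) := fun s x y x' y' =>
    ((IsAdjoint.rankOne x y).comp (IsAdjoint.rankOne x' y')).isAdjointable
  refine M.iota_mem_compacts_of_hasSum hS.left_cancel hp.symm
    ((ContinuousLinearMap.compL ℂ _ _ _).flip (M.iota q r T')) _ hξ.hasSum_rankOne_comp
    (fun x y i => adj₂ _ _ _ _ _) (fun x y i => ?_) hT
  rw [M.iota_comp hS.left_cancel hp.symm (adj₁ _ _ _) (adj₁ _ _ _)]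
  show ((M.iota p r (rankOne A x y)).comp (M.iota p r (rankOne A (ξ i) (ξ i)))).comp
    (M.iota q r T') ∈ compacts A (M.Fibre r)
  rw [ContinuousLinearMap.comp_assoc]
  refine comp_mem_compacts (R := M.iota p r (rankOne A x y))
    (M.isAdjointable_iota hS.left_cancel hp.symm (adj₁ _ _ _)) ?_
  refine M.iota_mem_compacts_of_hasSum hS.left_cancel hq.symm
    (ContinuousLinearMap.compL ℂ _ _ _ (M.iota p r (rankOne A (ξ i) (ξ i)))) _
    hη.hasSum_comp_rankOne (fun x y i => adj₂ _ _ _ _ _) (fun x y j => ?_) hT'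
  rw [M.iota_comp hS.left_cancel hq.symm (adj₁ _ _ _) (adj₁ _ _ _)]
  exact compacts_comp_mem (R := M.iota q r (rankOne A x y))
    (M.isAdjointable_iota hS.left_cancel hq.symm (adj₁ _ _ _)) (hc i j)

end ProductSystem

end CStarProductSystem

namespace CStarProductSystem

universe u v w

open RightHilbertBimodule Filter Topology

/-! ### Self-adjoint idempotents and strong convergence. -/

section Projections

variable {A : Type u} {E : Type v} [CStarAlgebra A] [NormedAddCommGroup E]
    [NormedSpace ℂ E] [RightHilbertBimodule A E]

theorem IsAdjoint.norm_le_one_of_idempotent {T : E →L[ℂ] E} (hT : IsAdjoint A T T)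
    (h : T.comp T = T) : ‖T‖ ≤ 1 := by
  refine ContinuousLinearMap.opNorm_le_bound _ zero_le_one fun x => ?_
  have h1 : ‖T x‖ ^ 2 ≤ ‖x‖ * ‖T x‖ := by
    rw [norm_sq (A := A), hT, ← ContinuousLinearMap.comp_apply, h]
    exact norm_ip_le A _ _
  rcases (norm_nonneg (T x)).eq_or_lt with h0 | h0
  · rw [← h0]; positivity
  · exact le_of_mul_le_mul_right (by linarith) h0

/-- The reindexing serves `ConditionCA`, whose index types live in `Type`, while coset spaces live
in the universe of the group. -/
theorem isParsevalFrame_of_hasSum_rankOne {I : Type w} {J : Type*} [Countable J] {ξ : J → E}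
    (e : I ≃ J) (h : ∀ x, HasSum (fun j => rankOne A (ξ j) (ξ j) x) x) :
    IsParsevalFrame A fun i => ξ (e i) :=
  ⟨e.injective.countable, fun x => e.hasSum_iff.2 (h x)⟩

theorem IsAdjoint.sum {ι : Type*} (s : Finset ι) {T T' : ι → E →L[ℂ] E}
    (h : ∀ i, IsAdjoint A (T i) (T' i)) : IsAdjoint A (∑ i ∈ s, T i) (∑ i ∈ s, T' i) := by
  classical
  induction s using Finset.induction_on with
  | empty => exact IsAdjoint.zero
  | insert i s hi ih =>
    rw [Finset.sum_insert hi, Finset.sum_insert hi]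
    exact (h i).add ih

end Projections

/-- For a uniformly bounded family of operators, strong convergence to `S` on a set that spans a
dense subspace implies strong convergence to `S`. -/
theorem tendsto_of_dense_span {ι E F : Type*} [NormedAddCommGroup E] [NormedSpace ℂ E]
    [NormedAddCommGroup F] [NormedSpace ℂ F] {l : Filter ι} {T : ι → E →L[ℂ] F} {S : E →L[ℂ] F}
    {C : NNReal} (hT : ∀ i, ‖T i‖ ≤ C) {s : Set E}
    (h : ∀ x ∈ s, Tendsto (fun i => T i x) l (𝓝 (S x))) {x : E}
    (hx : x ∈ (Submodule.span ℂ s).topologicalClosure) :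
    Tendsto (fun i => T i x) l (𝓝 (S x)) := by
  let K : Submodule ℂ E :=
    { carrier := {x | Tendsto (fun i => T i x) l (𝓝 (S x))}
      zero_mem' := by simpa using tendsto_const_nhds
      add_mem' := fun {x y} hx hy => by simpa using Tendsto.add hx hy
      smul_mem' := fun c x hx => by simpa using Tendsto.const_smul hx c }
  -- The uniform bound makes the family equicontinuous, and for such a family the set of points of
  -- convergence to a continuous limit is closed.
  have hK : IsClosed (K : Set E) :=
    (LipschitzWith.uniformEquicontinuous (fun i => (T i : E → F)) C fun i =>
      (T i).lipschitz.weaken (hT i)).equicontinuous.isClosed_setOfPred_tendsto S.continuous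
  exact Submodule.topologicalClosure_minimal _ ((Submodule.span_le (p := K)).2 h) hK hx

section Compacts

variable {A : Type u} {E : Type v} [CStarAlgebra A] [NormedAddCommGroup E]
    [NormedSpace ℂ E] [RightHilbertBimodule A E]

/-- If a bounded net of adjointable operators converges strongly to zero, then its composition with
a compact operator converges in norm to zero. -/
theorem tendsto_comp_compact {ι : Type*} {l : Filter ι} {T : ι → E →L[ℂ] E} {C : NNReal}
    (hT : ∀ i, ‖T i‖ ≤ C) (hadj : ∀ i, IsAdjointable A (T i))
    (h : ∀ x, Tendsto (fun i => T i x) l (𝓝 0)) {K : E →L[ℂ] E} (hK : K ∈ compacts A E) :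
    Tendsto (fun i => (T i).comp K) l (𝓝 0) := by
  -- Left composition with `T i` is again bounded by `C`, now as an operator on operators. It is
  -- enough to test on rank-one operators, where `T_i Θ_{x,y} = Θ_{T_i x, y}` tends to zero in norm.
  refine tendsto_of_dense_span (T := fun i => ContinuousLinearMap.compL ℂ E E E (T i)) (S := 0)
    (C := C) (fun i => ?_) ?_ hK
  · refine ContinuousLinearMap.opNorm_le_bound _ C.2 fun R => ?_
    exact (ContinuousLinearMap.opNorm_comp_le _ _).trans (by gcongr; exact hT i)
  · rintro _ ⟨x, y, rfl⟩
    have h1 := ((rankOneL A y).continuous.tendsto 0).comp (h x)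
    rw [map_zero] at h1
    refine h1.congr fun i => ?_
    obtain ⟨T', hT'⟩ := hadj i
    exact (IsAdjoint.comp_rankOne hT' x y).symm

end Compacts

/-! ### The trivial representation and the norm of the unit of `C⋆(G)`. -/

namespace GroupAlg

variable {G : Type u} [Group G]

/-- The trivial representation of the group algebra. -/
noncomputable def trivialRep : GroupAlg G →ₐ[ℂ] ℂ := MonoidAlgebra.lift ℂ ℂ G 1

theorem trivialRep_delta (g : G) : trivialRep (delta g) = 1 := by
  refine (MonoidAlgebra.lift_single (1 : G →* ℂ) g (1 : ℂ)).trans ?_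
  simp

theorem trivialRep_star (x : GroupAlg G) : trivialRep (star x) = star (trivialRep x) := by
  induction x using induction with
  | zero => simp
  | add x y hx hy => rw [star_add, map_add, hx, hy, map_add, star_add]
  | single g c =>
    rw [star_smul, star_delta, map_smul, map_smul, star_smul, trivialRep_delta, trivialRep_delta,
      star_one]

theorem isCStarSeminorm_trivialRep :
    IsCStarSeminorm ((normSeminorm ℂ ℂ).comp (trivialRep (G := G)).toLinearMap) := by
  refine ⟨fun x y => ?_, fun x => ?_⟩
  · show ‖trivialRep (x * y)‖ ≤ ‖trivialRep x‖ * ‖trivialRep y‖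
    rw [map_mul, norm_mul]
  · show ‖trivialRep (star x * x)‖ = ‖trivialRep x‖ ^ 2
    rw [map_mul, trivialRep_star, norm_mul, norm_star, sq]

/-- The lower bound needs a nonzero C⋆-seminorm inside the supremum `maxNorm`; the trivial
representation supplies one. This is what makes the `π_p(δ_g)` unit vectors. -/
theorem norm_one_eq : ‖(1 : GroupAlg G)‖ = 1 := by
  refine le_antisymm (norm_delta_le 1) ?_
  have h : ‖trivialRep (1 : GroupAlg G)‖ ≤ ‖(1 : GroupAlg G)‖ :=
    le_maxNorm isCStarSeminorm_trivialRep 1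
  rwa [map_one, norm_one] at h

end GroupAlg

namespace GroupCStar

variable {G : Type u} [Group G]

theorem δ_mul (g h : G) : δ g * δ h = δ (g * h) := by
  rw [δ, δ, ← incl_mul, GroupAlg.delta_mul]; rfl

theorem star_δ (g : G) : star (δ g) = δ g⁻¹ := by
  rw [δ, star_incl, GroupAlg.star_delta]; rfl

theorem δ_one : δ (1 : G) = 1 := rfl

theorem norm_one_eq : ‖(1 : GroupCStar G)‖ = 1 :=
  (norm_incl 1).trans GroupAlg.norm_one_eq

end GroupCStar

/-! ### Coset projections in the product system of an algebraic dynamical system. -/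

namespace AlgebraicDynamicalSystem

open GroupCStar

variable {G : Type u} {P : Type v} [Group G] [Monoid P] (Φ : AlgebraicDynamicalSystem G P)

theorem lact_pi (p : P) (a b : GroupCStar G) :
    (lact a (Φ.pi p b) : Φ.productSystem.Fibre p) = Φ.pi p (a * b) :=
  Φ.exelLarsenSystem.lactC_pi p a b

theorem ract_pi (p : P) (a b : GroupCStar G) :
    (ract (Φ.pi p a) b : Φ.productSystem.Fibre p) = Φ.pi p (a * GroupCStar.map (Φ.θ p) b) :=
  Φ.exelLarsenSystem.ractC_pi p a b

theorem ip_pi (p : P) (a b : GroupCStar G) :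
    (ip (Φ.pi p a) (Φ.pi p b) : GroupCStar G) = restrict (Φ.injective p) (star a * b) :=
  Φ.exelLarsenSystem.ip_pi p a b

theorem denseRange_pi (p : P) : DenseRange (Φ.pi p) :=
  Φ.exelLarsenSystem.denseRange_pi p

/-- `π_p` as a bounded linear map. -/
noncomputable def piL (p : P) : GroupCStar G →L[ℂ] Φ.productSystem.Fibre p :=
  (lact (A := GroupCStar G) (E := Φ.productSystem.Fibre p)).flip (Φ.pi p 1)

theorem piL_apply (p : P) (a : GroupCStar G) : Φ.piL p a = Φ.pi p a := by
  show (lact a (Φ.pi p 1) : Φ.productSystem.Fibre p) = _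
  rw [lact_pi, mul_one]

/-- The `π_p(δ_g)` have dense span. The operator identities below thus become statements about
membership in cosets. -/
theorem fibre_clm_ext {p : P} {F : Type*} [NormedAddCommGroup F] [NormedSpace ℂ F]
    {S T : Φ.productSystem.Fibre p →L[ℂ] F} (h : ∀ g, S (Φ.pi p (δ g)) = T (Φ.pi p (δ g))) :
    S = T := by
  ext x
  refine (Φ.denseRange_pi p).induction_on (p := fun x => S x = T x) x
    (isClosed_eq S.continuous T.continuous) fun a => ?_
  have := clm_ext (S := S.comp (Φ.piL p)) (T := T.comp (Φ.piL p)) (fun g => by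
    simpa only [ContinuousLinearMap.comp_apply, piL_apply] using h g) a
  simpa only [ContinuousLinearMap.comp_apply, piL_apply] using this

theorem span_pi_δ (p : P) :
    (Submodule.span ℂ (Set.range fun g => Φ.pi p (δ g))).topologicalClosure = ⊤ := by
  set K := (Submodule.span ℂ (Set.range fun g => Φ.pi p (δ g))).topologicalClosure with hK
  have hc : IsClosed (K : Set (Φ.productSystem.Fibre p)) :=
    Submodule.isClosed_topologicalClosure _
  refine Submodule.eq_top_iff'.2 fun x => ?_
  refine (Φ.denseRange_pi p).induction_on (p := fun x => x ∈ K) x hc fun a => ?_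
  rw [← piL_apply]
  induction a using GroupCStar.ind with
  | hc => exact hc.preimage (Φ.piL p).continuous
  | h a =>
    induction a using GroupAlg.induction with
    | zero => rw [map_zero, map_zero]; exact zero_mem _
    | add x y hx hy => rw [map_add, map_add]; exact add_mem hx hy
    | single g c =>
      rw [map_smul, map_smul]
      refine Submodule.smul_mem _ c (Submodule.le_topologicalClosure _ (Submodule.subset_span ?_))
      exact ⟨g, (Φ.piL_apply p (δ g)).symm⟩

/-- The projection of `M_p` onto the closed span of the `π_p(δ_h)` with `h ∈ g θ_p(G)`. -/
noncomputable def cosetProj (p : P) (g : G) :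
    Φ.productSystem.Fibre p →L[ℂ] Φ.productSystem.Fibre p :=
  rankOne (GroupCStar G) (Φ.pi p (δ g)) (Φ.pi p (δ g))

theorem isAdjoint_cosetProj (p : P) (g : G) :
    IsAdjoint (GroupCStar G) (Φ.cosetProj p g) (Φ.cosetProj p g) := IsAdjoint.rankOne _ _

open Classical in
-- The inner product of `π_p(δ_g)` and `π_p(δ_h)` is `L_p(δ_{g⁻¹h})`. It vanishes unless `g⁻¹h =
-- θ_p(k)`, and then it is `δ_k` and `π_p(δ_g) · δ_k = π_p(δ_h)`.
theorem cosetProj_pi_δ (p : P) (g h : G) :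
    Φ.cosetProj p g (Φ.pi p (δ h)) =
      if (g : G ⧸ (Φ.θ p).range) = h then Φ.pi p (δ h) else 0 := by
  rw [cosetProj, rankOne_apply, ip_pi, ract_pi, star_δ, δ_mul]
  split_ifs with hg
  · obtain ⟨k, hk⟩ := QuotientGroup.eq.1 hg
    rw [← hk, restrict_δ, map_δ, δ_mul, hk, mul_inv_cancel_left]
  · rw [restrict_δ_of_notMem, map_zero, mul_zero, map_zero]
    exact fun hk => hg (QuotientGroup.eq.2 hk)

open Classical in
-- Since `π_r(δ_h) = π_p(δ_h) π_q(δ_1)`, the amplification acts on the first factor with the same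
-- `h`. It therefore still tests cosets of `θ_p(G)`, not of the smaller group `θ_r(G)`.
theorem iota_cosetProj_pi_δ {p q r : P} (hr : p * q = r) (g h : G) :
    Φ.productSystem.iota p r (Φ.cosetProj p g) (Φ.pi r (δ h)) =
      if (g : G ⧸ (Φ.θ p).range) = h then Φ.pi r (δ h) else 0 := by
  have h1 := ((Φ.productSystem.isAmplification_iota hr Φ.rightLCM.left_cancel (Φ.cosetProj p g)
    (Φ.isAdjoint_cosetProj p g).isAdjointable).2 q hr).1 (Φ.pi p (δ h)) (Φ.pi q (δ 1))
  rw [cosetProj_pi_δ] at h1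
  have h2 := Φ.mul_pi_δ hr h 1
  rw [map_one, mul_one] at h2
  rw [h2] at h1
  rw [h1]
  split_ifs
  · exact h2
  · rw [map_zero]; rfl

open Classical in
theorem sum_cosetProj_pi_δ (p : P) (s : Finset (G ⧸ (Φ.θ p).range)) (h : G) :
    (∑ c ∈ s, Φ.cosetProj p c.out) (Φ.pi p (δ h)) =
      if (h : G ⧸ (Φ.θ p).range) ∈ s then Φ.pi p (δ h) else 0 := by
  rw [sum_apply]
  simp_rw [cosetProj_pi_δ, QuotientGroup.out_eq']
  rw [Finset.sum_ite_eq']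

/-- Distinct cosets are disjoint, so the finite sum is itself a self-adjoint idempotent; the bound
is uniform in `s`, as strong convergence requires. -/
theorem norm_sum_cosetProj_le (p : P) (s : Finset (G ⧸ (Φ.θ p).range)) :
    ‖∑ c ∈ s, Φ.cosetProj p c.out‖ ≤ 1 := by
  classical
  refine (IsAdjoint.sum s fun c =>
    Φ.isAdjoint_cosetProj p (Quotient.out c)).norm_le_one_of_idempotent (Φ.fibre_clm_ext fun h => ?_)
  rw [ContinuousLinearMap.comp_apply, sum_cosetProj_pi_δ]
  split_ifs with hs
  · rw [sum_cosetProj_pi_δ, if_pos hs]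
  · rw [map_zero]

/-- The projections onto the cosets of `θ_p(G)` sum up strongly to the identity. -/
theorem hasSum_cosetProj (p : P) (x : Φ.productSystem.Fibre p) :
    HasSum (fun c : G ⧸ (Φ.θ p).range => Φ.cosetProj p c.out x) x := by
  classical
  have h := tendsto_of_dense_span (l := atTop) (x := x)
    (T := fun s : Finset (G ⧸ (Φ.θ p).range) => ∑ c ∈ s, Φ.cosetProj p c.out)
    (S := ContinuousLinearMap.id ℂ _) (C := 1) (Φ.norm_sum_cosetProj_le p)
    (s := Set.range fun g => Φ.pi p (δ g)) ?_ (by rw [span_pi_δ]; trivial)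
  · refine h.congr fun s => ?_
    rw [sum_apply]
  · rintro _ ⟨g, rfl⟩
    -- On `π_p(δ_g)` the partial sums are constant as soon as `s` contains the coset of `g`.
    refine tendsto_const_nhds.congr' ?_
    filter_upwards [eventually_ge_atTop {(g : G ⧸ (Φ.θ p).range)}] with s hs
    rw [sum_cosetProj_pi_δ, if_pos (hs (Finset.mem_singleton_self _))]
    rfl

theorem countable_quotient (p : P) : Countable (G ⧸ (Φ.θ p).range) :=
  have := Φ.countable_group
  Quotient.countable

/-- The elements `π_p(δ_g)` of `M_p` for `g` in a transversal of `G / θ_p(G)`. -/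
noncomputable def transversal (p : P) (c : G ⧸ (Φ.θ p).range) : Φ.productSystem.Fibre p :=
  Φ.pi p (δ c.out)

theorem isParsevalFrame_transversal {p : P} {I : Type w} (e : I ≃ G ⧸ (Φ.θ p).range) :
    IsParsevalFrame (GroupCStar G) fun i => Φ.transversal p (e i) :=
  have := Φ.countable_quotient p
  isParsevalFrame_of_hasSum_rankOne e (Φ.hasSum_cosetProj p)

/-- This is the order condition `θ_p(G) ∩ θ_q(G) = θ_r(G)` in terms of cosets, and the only place
where the argument uses it. -/
theorem coe_eq_coe_iff {p q r : P} (h : rightIdeal p ∩ rightIdeal q = rightIdeal r) (g k : G) :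
    (g : G ⧸ (Φ.θ r).range) = k ↔
      (g : G ⧸ (Φ.θ p).range) = k ∧ (g : G ⧸ (Φ.θ q).range) = k := by
  rw [QuotientGroup.eq, QuotientGroup.eq, QuotientGroup.eq]
  exact (Set.ext_iff.1 (Φ.respects p q r h) (g⁻¹ * k)).symm

theorem iota_cosetProj_comp_mem_compacts {p q r : P}
    (h : rightIdeal p ∩ rightIdeal q = rightIdeal r) (g k : G) :
    (Φ.productSystem.iota p r (Φ.cosetProj p g)).comp
      (Φ.productSystem.iota q r (Φ.cosetProj q k)) ∈
        compacts (GroupCStar G) (Φ.productSystem.Fibre r) := by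
  classical
  obtain ⟨⟨p', hp⟩, ⟨q', hq⟩⟩ : r ∈ rightIdeal p ∩ rightIdeal q :=
    h ▸ ⟨1, (mul_one r).symm⟩
  have key : ∀ l : G, (Φ.productSystem.iota p r (Φ.cosetProj p g)).comp
      (Φ.productSystem.iota q r (Φ.cosetProj q k)) (Φ.pi r (δ l)) =
        if (g : G ⧸ (Φ.θ p).range) = l ∧ (k : G ⧸ (Φ.θ q).range) = l then Φ.pi r (δ l) else 0 := by
    intro l
    rw [ContinuousLinearMap.comp_apply, Φ.iota_cosetProj_pi_δ hq.symm]
    by_cases h2 : (k : G ⧸ (Φ.θ q).range) = l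
    · rw [if_pos h2, Φ.iota_cosetProj_pi_δ hp.symm]
      simp only [h2, and_true]
    · rw [if_neg h2, map_zero, if_neg fun h => h2 h.2]
  -- If the cosets `g θ_p(G)` and `k θ_q(G)` share an element `m`, their intersection is `m θ_r(G)`
  -- and the product is the rank-one projection of that coset; if they are disjoint, it is zero.
  by_cases hm : ∃ m : G, (g : G ⧸ (Φ.θ p).range) = m ∧ (k : G ⧸ (Φ.θ q).range) = m
  · obtain ⟨m, hm₁, hm₂⟩ := hm
    have : (Φ.productSystem.iota p r (Φ.cosetProj p g)).comp
        (Φ.productSystem.iota q r (Φ.cosetProj q k)) = Φ.cosetProj r m := by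
      refine Φ.fibre_clm_ext fun l => ?_
      rw [key, cosetProj_pi_δ, hm₁, hm₂]
      simp only [Φ.coe_eq_coe_iff h]
    rw [this]
    exact rankOne_mem_compacts _ _
  · have : (Φ.productSystem.iota p r (Φ.cosetProj p g)).comp
        (Φ.productSystem.iota q r (Φ.cosetProj q k)) = 0 := by
      refine Φ.fibre_clm_ext fun l => ?_
      rw [key, if_neg fun h => hm ⟨l, h⟩]
      rfl
    rw [this]
    exact zero_mem _

theorem conditionCA : Φ.productSystem.ConditionCA := by
  intro p q r h
  have := Φ.countable_quotient p
  have := Φ.countable_quotient q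
  -- Countability of the coset space allows an equivalent index type in `Type`, as `ConditionCA`
  -- demands.
  have : Small.{0} (G ⧸ (Φ.θ p).range) := Countable.toSmall _
  have : Small.{0} (G ⧸ (Φ.θ q).range) := Countable.toSmall _
  exact ⟨Shrink.{0} (G ⧸ (Φ.θ p).range), Shrink.{0} (G ⧸ (Φ.θ q).range), _, _,
    Φ.isParsevalFrame_transversal (equivShrink _).symm,
    Φ.isParsevalFrame_transversal (equivShrink _).symm,
    fun i j => Φ.iota_cosetProj_comp_mem_compacts h _ _⟩

theorem isCompactlyAligned : Φ.productSystem.IsCompactlyAligned :=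
  Φ.conditionCA.isCompactlyAligned Φ.rightLCM

theorem lact_one (p : P) :
    lact (1 : GroupCStar G) = ContinuousLinearMap.id ℂ (Φ.productSystem.Fibre p) :=
  Φ.fibre_clm_ext fun g => by rw [lact_pi, one_mul]; rfl

theorem norm_pi_δ (p : P) (g : G) : ‖Φ.pi p (δ g)‖ = 1 := by
  rw [← sq_eq_sq₀ (norm_nonneg _) zero_le_one, norm_sq (A := GroupCStar G), ip_pi, star_δ, δ_mul,
    inv_mul_cancel, ← map_one (Φ.θ p), restrict_δ, δ_one, norm_one_eq, one_pow]

/-- `C⋆(G)` acts on `M_p` by compacts if and only if `θ_p(G)` has finite index. -/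
theorem leftActsByCompacts_iff (p : P) :
    LeftActsByCompacts (GroupCStar G) (Φ.productSystem.Fibre p) ↔
      Finite (G ⧸ (Φ.θ p).range) := by
  constructor
  · intro h
    by_contra hinf
    rw [not_finite_iff_infinite] at hinf
    -- The left action is unital, so the element `1` already forces the identity of `M_p` to be
    -- compact.
    have h1 := h 1
    rw [lact_one] at h1
    have hle : ∀ c : G ⧸ (Φ.θ p).range, ‖Φ.cosetProj p c.out‖ ≤ (1 : NNReal) := fun c => by
      simpa using Φ.norm_sum_cosetProj_le p {c}
    -- The terms of the strongly convergent sum of coset projections tend to zero along the cofinite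
    -- filter; composing with the compact identity turns this into norm convergence.
    have h2 := tendsto_comp_compact (l := cofinite) hle
      (fun c => (Φ.isAdjoint_cosetProj p c.out).isAdjointable)
      (fun x => (Φ.hasSum_cosetProj p x).summable.tendsto_cofinite_zero) h1
    simp_rw [ContinuousLinearMap.comp_id] at h2
    -- Infinitely many cosets make the cofinite filter nontrivial, so some projection has norm below
    -- one, although it fixes the unit vector `π_p(δ_{c.out})`.
    obtain ⟨c, hc⟩ := (h2.norm.eventually_lt_const (u := 1) (by simp)).exists
    have h3 := (Φ.cosetProj p c.out).le_opNorm (Φ.pi p (δ c.out))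
    rw [cosetProj_pi_δ, if_pos rfl, norm_pi_δ, mul_one] at h3
    exact absurd hc h3.not_gt
  · intro hfin a
    have := Fintype.ofFinite (G ⧸ (Φ.θ p).range)
    -- With finitely many cosets the identity is a finite sum of rank-one operators, and `lact a` is
    -- its composite with an adjointable operator.
    have e : (∑ c : G ⧸ (Φ.θ p).range, Φ.cosetProj p c.out) = ContinuousLinearMap.id ℂ _ := by
      classical
      exact Φ.fibre_clm_ext fun g => by
        rw [sum_cosetProj_pi_δ, if_pos (Finset.mem_univ _)]; rfl
    have hid : ContinuousLinearMap.id ℂ _ ∈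
        compacts (GroupCStar G) (Φ.productSystem.Fibre p) := by
      rw [← e]
      exact Submodule.sum_mem _ fun c _ => rankOne_mem_compacts _ _
    have hadj : IsAdjointable (GroupCStar G) (lact a : _ →L[ℂ] Φ.productSystem.Fibre p) :=
      ⟨lact (star a), ip_lact_left a⟩
    simpa only [ContinuousLinearMap.comp_id] using comp_mem_compacts hadj hid

end AlgebraicDynamicalSystem

end CStarProductSystem

namespace CStarProductSystem

/-! ### An example of infinite index: the shift on `ℤ[X]`. -/

open Polynomial

/-- The action of `ℕ` on the additive group of `ℤ[X]` by multiplication by powers of `X`. -/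
noncomputable def polynomialShift :
    AlgebraicDynamicalSystem (Multiplicative ℤ[X]) (Multiplicative ℕ) where
  countable_group := by
    have : Countable ℤ[X] := by
      rw [← Cardinal.mk_le_aleph0_iff]
      exact Polynomial.cardinalMk_le_max.trans (by simp)
    exact inferInstanceAs (Countable ℤ[X])
  countable_semigroup := inferInstanceAs (Countable ℕ)
  rightLCM :=
    { left_cancel := fun p x y h => mul_left_cancel h
      lcm := fun p q => by
        have key : ∀ p q : ℕ, p ≤ q → rightIdeal (Multiplicative.ofAdd q) ⊆
            rightIdeal (Multiplicative.ofAdd p) := by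
          rintro p q h _ ⟨y, rfl⟩
          obtain ⟨k, rfl⟩ := Nat.exists_eq_add_of_le h
          exact ⟨Multiplicative.ofAdd k * y, by rw [← mul_assoc]; rfl⟩
        right
        rcases le_total p.toAdd q.toAdd with h | h
        · exact ⟨q, Set.inter_eq_right.2 (key _ _ h)⟩
        · exact ⟨p, Set.inter_eq_left.2 (key _ _ h)⟩ }
  θ n := AddMonoidHom.toMultiplicative (AddMonoidHom.mulLeft (X ^ n.toAdd : ℤ[X]))
  θ_one g := by
    show Multiplicative.ofAdd ((X ^ 0 : ℤ[X]) * g.toAdd) = g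
    rw [pow_zero, one_mul]; rfl
  θ_mul p q g := by
    show Multiplicative.ofAdd ((X ^ (p.toAdd + q.toAdd) : ℤ[X]) * g.toAdd) =
      Multiplicative.ofAdd ((X ^ p.toAdd : ℤ[X]) * ((X ^ q.toAdd : ℤ[X]) * g.toAdd))
    rw [pow_add, mul_assoc]
  injective p x y h := by
    have h' : (X ^ p.toAdd : ℤ[X]) * x.toAdd = (X ^ p.toAdd : ℤ[X]) * y.toAdd := h
    exact mul_left_cancel₀ (M₀ := ℤ[X]) (pow_ne_zero _ X_ne_zero) h'
  respects p q r h := by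
    have key : ∀ p q : Multiplicative ℕ, q ∈ rightIdeal p →
        Set.range (AddMonoidHom.toMultiplicative (AddMonoidHom.mulLeft (X ^ q.toAdd : ℤ[X]))) ⊆
        Set.range (AddMonoidHom.toMultiplicative (AddMonoidHom.mulLeft (X ^ p.toAdd : ℤ[X]))) := by
      rintro p _ ⟨y, rfl⟩ _ ⟨f, rfl⟩
      refine ⟨Multiplicative.ofAdd ((X ^ y.toAdd : ℤ[X]) * f.toAdd), ?_⟩
      show (X ^ p.toAdd : ℤ[X]) * ((X ^ y.toAdd : ℤ[X]) * f.toAdd) =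
        (X ^ (p.toAdd + y.toAdd) : ℤ[X]) * f.toAdd
      rw [pow_add, mul_assoc]
    have hr : r ∈ rightIdeal p ∩ rightIdeal q := h ▸ ⟨1, (mul_one r).symm⟩
    refine Set.Subset.antisymm ?_ (Set.subset_inter (key _ _ hr.1) (key _ _ hr.2))
    have hle : ∀ p q : Multiplicative ℕ, p.toAdd ≤ q.toAdd → q ∈ rightIdeal p := fun p q h =>
      ⟨Multiplicative.ofAdd (q.toAdd - p.toAdd), (Nat.add_sub_cancel' h).symm⟩
    -- Principal ideals of `ℕ` form a chain. The larger of `p` and `q` lies in both ideals, hence in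
    -- that of `r`, so its range is contained in that of `θ r`.
    rcases le_total p.toAdd q.toAdd with hpq | hpq
    · refine Set.inter_subset_right.trans (key _ _ ?_)
      rw [← h]
      exact ⟨hle _ _ hpq, hle _ _ le_rfl⟩
    · refine Set.inter_subset_left.trans (key _ _ ?_)
      rw [← h]
      exact ⟨hle _ _ le_rfl, hle _ _ hpq⟩

/-- Distinct integer constants stay distinct modulo `X ^ n` for `n ≥ 1`, because every multiple of
`X ^ n` has constant coefficient zero. -/
theorem infinite_quotient_polynomialShift {p : Multiplicative ℕ} (hp : p ≠ 1) :
    Infinite (Multiplicative ℤ[X] ⧸ (polynomialShift.θ p).range) := by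
  refine Infinite.of_injective
    (fun k : ℤ => ((Multiplicative.ofAdd (C k) : Multiplicative ℤ[X]) :
      Multiplicative ℤ[X] ⧸ (polynomialShift.θ p).range)) fun k l h => ?_
  obtain ⟨f, hf⟩ := QuotientGroup.eq.1 h
  have hf' : (X ^ p.toAdd : ℤ[X]) * f.toAdd = -C k + C l := hf
  have h0 := congrArg (coeff · 0) hf'
  have hp' : p.toAdd ≠ 0 := hp
  rw [mul_coeff_zero, coeff_X_pow, if_neg hp'.symm, zero_mul, coeff_add, coeff_neg, coeff_C_zero,
    coeff_C_zero] at h0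
  omega

end CStarProductSystem

theorem proposition7p6 :
    -- over a right LCM semigroup and a unital C⋆-algebra, (CA) implies compact alignment
    (∀ (A : Type uA) (S : Type uS) [CStarAlgebra A] [Monoid S], IsRightLCM S →
      ∀ M : ProductSystem.{uA, uS, uM} A S, M.ConditionCA → M.IsCompactlyAligned) ∧
    -- the product system of an algebraic dynamical system is compactly aligned, whether or not the
    -- left actions are by compacts, which for `M_p` means that `G / θ_p(G)` is finite
    (∀ (G : Type uG) (P : Type uP) [Group G] [Monoid P] (Φ : AlgebraicDynamicalSystem G P),
      Φ.productSystem.IsCompactlyAligned ∧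
      ∀ p : P, LeftActsByCompacts (GroupCStar G) (Φ.productSystem.Fibre p) ↔
        Finite (G ⧸ (Φ.θ p).range)) ∧
    -- it does happen that no left action, except the one on `M_1`, is by compacts
    (∃ (G P : Type) (_ : Group G) (_ : Monoid P) (Φ : AlgebraicDynamicalSystem G P),
      Nontrivial P ∧ Φ.productSystem.IsCompactlyAligned ∧
      ∀ p : P, p ≠ 1 → ¬ LeftActsByCompacts (GroupCStar G) (Φ.productSystem.Fibre p)) := by
  refine ⟨fun A S _ _ hS M hM => hM.isCompactlyAligned hS,
    fun G P _ _ Φ => ⟨Φ.isCompactlyAligned, Φ.leftActsByCompacts_iff⟩,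
    Multiplicative (Polynomial ℤ), Multiplicative ℕ, inferInstance, inferInstance,
    polynomialShift, inferInstance, polynomialShift.isCompactlyAligned, fun p hp h => ?_⟩
  have := infinite_quotient_polynomialShift hp
  exact not_finite_iff_infinite.2 this ((polynomialShift.leftActsByCompacts_iff p).1 h)
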